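/- Let $k$ be a field, $G$ a group, $\mathcal C$ its set of conjugacy classes, and choose $u(C)\in C$ for each $C\in\mathcal C$; let $Z_{u(C)}$ be the centralizer of $u(C)$ in $G$. Let $r=\sum_{C\in\mathcal C} r_C\,C$ be a ramification data, i.e. a formal sum of conjugacy classes with coefficients $r_C\in\mathbb Z_{\ge 0}$, and let $Q$ be the corresponding Hopf quiver: its vertices are the elements of $G$, and there are $r_C$ arrows from $x$ to $cx$ for every $x\in G$ and $c\in C$. Let $kQ$ be the path coalgebra: it has the paths of $Q$ as a basis, $\Delta(\alpha)=\sum_{\alpha=\alpha_{(2)}\alpha_{(1)}}\alpha_{(2)}\otimes\alpha_{(1)}$ (sum over all splits of the path $\alpha$), and $\varepsilon(\alpha)=1$ or $0$ according to whether $\alpha$ is a vertex or has positive length; it is graded by length, with $kQ_n$ the span of the paths of length $n$. A graded Hopf algebra structure on $kQ$ means a multiplication, a unit and an antipode, all compatible with the grading, which together with $\Delta$ and $\varepsilon$ make $kQ$ a Hopf algebra, and such that the vertices multiply as the elements of $G$ (so $kQ_0$ is the group algebra $kG$). Two such structures are isomorphic if there is an isomorphism of graded Hopf algebras between them which fixes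 every vertex. For such a structure, the isotypic component $${}^{u(C)}(kQ_1)^1=\{m\in kQ_1 : \delta_L(m)=u(C)\otimes m,\ \delta_R(m)=m\otimes 1\},$$ where $\delta_L(a)=t(a)\otimes a$ and $\delta_R(a)=a\otimes s(a)$ for an arrow $a$ with source $s(a)$ and target $t(a)$, is a right $kZ_{u(C)}$-module through $m\cdot z=z^{-1}mz$. Then assigning to a graded Hopf algebra structure on $kQ$ the family $\big({}^{u(C)}(kQ_1)^1\big)_{C\in\mathcal C}$ gives a one-to-one correspondence between the isomorphism classes of graded Hopf algebra structures on $kQ$ and the collections $\{M_C\}_{C\in\mathcal C}$, where each $M_C$ is a right $kZ_{u(C)}$-module with $\dim_k M_C=r_C$, considered up to isomorphism of each $M_C$. -/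

import Mathlib

open scoped TensorProduct

universe u v w

namespace HopfQuivers

noncomputable section

/-! ### The path coalgebra of a quiver -/

section PathCoalgebra

variable (k : Type u) [Field k] {V : Type v} [Quiver.{0} V]

variable (V) in
/-- The set of all paths of a quiver: `⟨a, b, p⟩` is a path `p` from `a` to `b`. -/
abbrev AllPaths : Type v := Σ a b : V, Quiver.Path a b

variable (V) in
/-- The vector space `kQ` with basis the set of paths of `Q`. -/
def PathCoalgebra : Type (max u v) := AllPaths V →₀ k

instance : AddCommGroup (PathCoalgebra k V) := inferInstanceAs (AddCommGroup (AllPaths V →₀ k))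

instance : Module k (PathCoalgebra k V) := inferInstanceAs (Module k (AllPaths V →₀ k))

variable (V) in
/-- The basis of `kQ` given by the paths. -/
def pathBasis : Module.Basis (AllPaths V) k (PathCoalgebra k V) := Finsupp.basisSingleOne

/-- A path, as an element of `kQ`. -/
def ofPath {a b : V} (p : Quiver.Path a b) : PathCoalgebra k V := pathBasis k V ⟨a, b, p⟩

/-- A vertex, as an element of `kQ` (a path of length zero). -/
def vertex (a : V) : PathCoalgebra k V := ofPath k (Quiver.Path.nil : Quiver.Path a a)

/-- The splits of a path `p = p₂ p₁`, first `p₁` and then `p₂`; the split is recorded as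
the triple of the intermediate vertex, `p₂` and `p₁`. -/
def splits {a : V} : {b : V} → Quiver.Path a b → List (Σ c : V, Quiver.Path c b × Quiver.Path a c)
  | _, .nil => [⟨a, .nil, .nil⟩]
  | b, .cons p e => ⟨b, .nil, p.cons e⟩ :: (splits p).map fun s => ⟨s.1, s.2.1.cons e, s.2.2⟩

theorem mem_splits_iff {a b : V} (p : Quiver.Path a b)
    (s : Σ c : V, Quiver.Path c b × Quiver.Path a c) :
    s ∈ splits p ↔ s.2.2.comp s.2.1 = p := by
  induction p with
  | nil =>
    obtain ⟨c, q, t⟩ := s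
    constructor
    · intro h
      simp only [splits, List.mem_singleton] at h
      cases h; rfl
    · intro h
      cases q with
      | nil =>
        simp only [Quiver.Path.comp_nil] at h
        subst h; simp [splits]
      | cons q f => exact absurd h (by simp)
  | cons p e ih =>
    obtain ⟨c, q, t⟩ := s
    simp only [splits, List.mem_cons, List.mem_map]
    constructor
    · rintro (h | ⟨s, hs, h⟩)
      · cases h; rfl
      · cases h
        rw [Quiver.Path.comp_cons, (ih s).1 hs]
    · intro h
      cases q with
      | nil =>
        simp only [Quiver.Path.comp_nil] at h
        subst h; exact Or.inl rfl
      | cons q f =>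
        simp only [Quiver.Path.comp_cons] at h
        obtain rfl := Quiver.Path.obj_eq_of_cons_eq_cons h
        obtain rfl := eq_of_heq (Quiver.Path.heq_of_cons_eq_cons h)
        obtain rfl := eq_of_heq (Quiver.Path.hom_heq_of_cons_eq_cons h)
        exact Or.inr ⟨⟨c, q, t⟩, (ih _).2 rfl, rfl⟩

theorem nodup_splits {a b : V} (p : Quiver.Path a b) : (splits p).Nodup := by
  induction p with
  | nil => simp [splits]
  | cons p e ih =>
    simp only [splits, List.nodup_cons, List.mem_map, not_exists, not_and]
    refine ⟨?_, ih.map ?_⟩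
    · rintro ⟨c, q, t⟩ - h
      have := congrArg (fun s => s.2.1.length + 0 * s.2.2.length) h
      simp at this
    · rintro ⟨c, q, t⟩ ⟨c', q', t'⟩ h
      simp only [Sigma.mk.injEq] at h
      obtain ⟨rfl, h⟩ := h
      have h := eq_of_heq h
      simp only [Prod.mk.injEq, Quiver.Path.cons.injEq, heq_eq_eq, true_and, and_true] at h
      obtain ⟨rfl, rfl⟩ := h
      rfl

/-- `Δ(p) = ∑ p₂ ⊗ p₁`, over all splits `p = p₂ p₁`. -/
def comulPath {a b : V} (p : Quiver.Path a b) : PathCoalgebra k V ⊗[k] PathCoalgebra k V :=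
  ((splits p).map fun s => ofPath k s.2.1 ⊗ₜ[k] ofPath k s.2.2).sum

/-- The comultiplication is given on paths by splitting; the counit is `1` on vertices and `0`
on paths of positive length. -/
instance : CoalgebraStruct k (PathCoalgebra k V) where
  comul := (pathBasis k V).constr k fun p => comulPath k p.2.2
  counit := (pathBasis k V).constr k fun p => if p.2.2.length = 0 then 1 else 0

theorem comul_ofPath {a b : V} (p : Quiver.Path a b) :
    CoalgebraStruct.comul (R := k) (ofPath k p) = comulPath k p :=
  (pathBasis k V).constr_basis k _ _

theorem counit_ofPath {a b : V} (p : Quiver.Path a b) :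
    CoalgebraStruct.counit (R := k) (ofPath k p) = if p.length = 0 then 1 else 0 :=
  (pathBasis k V).constr_basis k _ _

theorem sum_map_eq {ι A B : Type*} [AddCommMonoid A] [AddCommMonoid B] [Module k A] [Module k B]
    (f : A →ₗ[k] B) (l : List ι) (g : ι → A) :
    f (l.map g).sum = (l.map fun i => f (g i)).sum := by
  rw [map_list_sum, List.map_map]; rfl

theorem splits_assoc {M : Type*} [AddCommMonoid M] {a b : V} (p : Quiver.Path a b)
    (F : ∀ c d : V, Quiver.Path d b → Quiver.Path c d → Quiver.Path a c → M) :
    ((splits p).map fun s => ((splits s.2.1).map fun t => F s.1 t.1 t.2.1 t.2.2 s.2.2).sum).sum =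
      ((splits p).map fun s =>
        ((splits s.2.2).map fun t => F t.1 s.1 s.2.1 t.2.1 t.2.2).sum).sum := by
  induction p with
  | nil => simp [splits]
  | cons p e ih =>
    have := ih fun c d q₃ q₂ q₁ => F c d (q₃.cons e) q₂ q₁
    simp only [splits, List.map_cons, List.map_map, List.sum_cons, List.map_nil, List.sum_nil,
      Function.comp_def, List.sum_map_add, add_zero] at this ⊢
    rw [this]
    simp only [add_assoc]

instance : Coalgebra k (PathCoalgebra k V) where
  coassoc := by
    refine (pathBasis k V).ext ?_
    rintro ⟨a, b, p⟩
    change (TensorProduct.assoc k _ _ _).toLinearMap (LinearMap.rTensor _ _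
      (CoalgebraStruct.comul (R := k) (ofPath k p))) =
      LinearMap.lTensor _ _ (CoalgebraStruct.comul (R := k) (ofPath k p))
    simp only [comul_ofPath, comulPath, sum_map_eq, LinearMap.rTensor_tmul, LinearMap.lTensor_tmul]
    have h1 : ∀ s : Σ c : V, Quiver.Path c b × Quiver.Path a c,
        (((splits s.2.1).map fun t => ofPath k t.2.1 ⊗ₜ[k] ofPath k t.2.2).sum ⊗ₜ[k]
          ofPath k s.2.2) = ((splits s.2.1).map fun t =>
            (ofPath k t.2.1 ⊗ₜ[k] ofPath k t.2.2) ⊗ₜ[k] ofPath k s.2.2).sum := fun s =>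
      sum_map_eq k ((TensorProduct.mk k _ _).flip (ofPath k s.2.2)) _ _
    have h2 : ∀ s : Σ c : V, Quiver.Path c b × Quiver.Path a c,
        (ofPath k s.2.1 ⊗ₜ[k]
          ((splits s.2.2).map fun t => ofPath k t.2.1 ⊗ₜ[k] ofPath k t.2.2).sum) =
          ((splits s.2.2).map fun t =>
            ofPath k s.2.1 ⊗ₜ[k] (ofPath k t.2.1 ⊗ₜ[k] ofPath k t.2.2)).sum := fun s =>
      sum_map_eq k (TensorProduct.mk k _ _ (ofPath k s.2.1)) _ _
    simp only [h1, h2, sum_map_eq, LinearEquiv.coe_coe, TensorProduct.assoc_tmul]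
    exact splits_assoc p fun c d q₃ q₂ q₁ =>
      ofPath k q₃ ⊗ₜ[k] (ofPath k q₂ ⊗ₜ[k] ofPath k q₁)
  rTensor_counit_comp_comul := by
    refine (pathBasis k V).ext ?_
    rintro ⟨a, b, p⟩
    change LinearMap.rTensor _ _ (CoalgebraStruct.comul (R := k) (ofPath k p)) =
      (1 : k) ⊗ₜ[k] ofPath k p
    simp only [comul_ofPath, comulPath, sum_map_eq, LinearMap.rTensor_tmul, counit_ofPath]
    cases p <;> simp [splits, Function.comp_def]
  lTensor_counit_comp_comul := by
    refine (pathBasis k V).ext ?_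
    rintro ⟨a, b, p⟩
    change LinearMap.lTensor _ _ (CoalgebraStruct.comul (R := k) (ofPath k p)) =
      ofPath k p ⊗ₜ[k] (1 : k)
    simp only [comul_ofPath, comulPath, sum_map_eq, LinearMap.lTensor_tmul, counit_ofPath]
    suffices h : ∀ {M : Type (max u v)} [AddCommGroup M] [Module k M]
        (F : ∀ c : V, Quiver.Path c b → k → M), (∀ c q, F c q 0 = 0) →
        ((splits p).map fun s => F s.1 s.2.1 (if s.2.2.length = 0 then 1 else 0)).sum =
          F a p 1 from
      h (fun c q x => ofPath k q ⊗ₜ[k] x) (by simp)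
    intro M _ _ F hF
    induction p with
    | nil => simp [splits]
    | cons p e ih =>
      have := ih (fun c q x => F c (q.cons e) x) (fun _ _ => hF _ _)
      simp only [splits, List.map_cons, List.map_map, List.sum_cons, Function.comp_def] at this ⊢
      rw [this]
      simp [hF]

variable (V) in
/-- `kQₙ`, the span of the paths of length `n`. -/
def degreePart (n : ℕ) : Submodule k (PathCoalgebra k V) :=
  Submodule.span k {x | ∃ (a b : V) (p : Quiver.Path a b), p.length = n ∧ x = ofPath k p}

variable (V) in
/-- The left `kQ₀`-coaction `a ↦ t(a) ⊗ a`, with `kQ₀` seen inside `kQ`. -/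
def leftCoaction : PathCoalgebra k V →ₗ[k] PathCoalgebra k V ⊗[k] PathCoalgebra k V :=
  (pathBasis k V).constr k fun p => vertex k p.2.1 ⊗ₜ[k] ofPath k p.2.2

variable (V) in
/-- The right `kQ₀`-coaction `a ↦ a ⊗ s(a)`, with `kQ₀` seen inside `kQ`. -/
def rightCoaction : PathCoalgebra k V →ₗ[k] PathCoalgebra k V ⊗[k] PathCoalgebra k V :=
  (pathBasis k V).constr k fun p => ofPath k p.2.2 ⊗ₜ[k] vertex k p.1

/-- The `(y, x)`-isotypic component `{z ∈ kQ₁ | δ_L z = y ⊗ z, δ_R z = z ⊗ x}` of the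
`kQ₀`-bicomodule `kQ₁`. -/
def isotypic (y x : V) : Submodule k (PathCoalgebra k V) where
  carrier := {z | z ∈ degreePart k V 1 ∧ leftCoaction k V z = vertex k y ⊗ₜ[k] z ∧
    rightCoaction k V z = z ⊗ₜ[k] vertex k x}
  add_mem' := by
    rintro z z' ⟨h1, h2, h3⟩ ⟨h1', h2', h3'⟩
    exact ⟨add_mem h1 h1', by rw [map_add, h2, h2', TensorProduct.tmul_add],
      by rw [map_add, h3, h3', TensorProduct.add_tmul]⟩
  zero_mem' := ⟨zero_mem _, by simp, by simp⟩
  smul_mem' := by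
    rintro c z ⟨h1, h2, h3⟩
    exact ⟨Submodule.smul_mem _ _ h1, by rw [map_smul, h2, TensorProduct.tmul_smul],
      by rw [map_smul, h3, TensorProduct.smul_tmul']⟩

variable (V) in
/-- The projection of `kQ` onto `kQ₀`. -/
def projZero : PathCoalgebra k V →ₗ[k] PathCoalgebra k V :=
  (pathBasis k V).constr k fun p => if p.2.2.length = 0 then ofPath k p.2.2 else 0

theorem projZero_ofPath {a b : V} (p : Quiver.Path a b) :
    projZero k V (ofPath k p) = if p.length = 0 then ofPath k p else 0 :=
  (pathBasis k V).constr_basis k _ _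

theorem leftCoaction_ofPath {a b : V} (p : Quiver.Path a b) :
    leftCoaction k V (ofPath k p) = vertex k b ⊗ₜ[k] ofPath k p :=
  (pathBasis k V).constr_basis k _ _

theorem rightCoaction_ofPath {a b : V} (p : Quiver.Path a b) :
    rightCoaction k V (ofPath k p) = ofPath k p ⊗ₜ[k] vertex k a :=
  (pathBasis k V).constr_basis k _ _

theorem leftCoaction_eq (z : PathCoalgebra k V) :
    leftCoaction k V z = (projZero k V).rTensor _ (CoalgebraStruct.comul (R := k) z) := by
  have : leftCoaction k V = (projZero k V).rTensor _ ∘ₗ CoalgebraStruct.comul (R := k) := by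
    refine (pathBasis k V).ext ?_
    rintro ⟨a, b, p⟩
    change leftCoaction k V (ofPath k p) =
      (projZero k V).rTensor _ (CoalgebraStruct.comul (R := k) (ofPath k p))
    rw [leftCoaction_ofPath, comul_ofPath, comulPath, sum_map_eq]
    simp only [LinearMap.rTensor_tmul, projZero_ofPath]
    cases p <;> simp [splits, Function.comp_def, vertex]
  rw [this]; rfl

theorem rightCoaction_eq (z : PathCoalgebra k V) :
    rightCoaction k V z = (projZero k V).lTensor _ (CoalgebraStruct.comul (R := k) z) := by
  have : rightCoaction k V = (projZero k V).lTensor _ ∘ₗ CoalgebraStruct.comul (R := k) := by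
    refine (pathBasis k V).ext ?_
    rintro ⟨a, b, p⟩
    change rightCoaction k V (ofPath k p) =
      (projZero k V).lTensor _ (CoalgebraStruct.comul (R := k) (ofPath k p))
    rw [rightCoaction_ofPath, comul_ofPath, comulPath, sum_map_eq]
    simp only [LinearMap.lTensor_tmul, projZero_ofPath]
    suffices h : ∀ {M : Type (max u v)} [AddCommGroup M] [Module k M]
        (F : ∀ c : V, Quiver.Path c b → PathCoalgebra k V → M), (∀ c q, F c q 0 = 0) →
        F a p (vertex k a) = ((splits p).map fun s =>
          F s.1 s.2.1 (if s.2.2.length = 0 then ofPath k s.2.2 else 0)).sum from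
      h (fun c q x => ofPath k q ⊗ₜ[k] x) (by simp)
    intro M _ _ F hF
    induction p with
    | nil => simp [splits, vertex]
    | cons p e ih =>
      have := ih (fun c q x => F c (q.cons e) x) (fun _ _ => hF _ _)
      simp only [splits, List.map_cons, List.map_map, List.sum_cons, Function.comp_def] at this ⊢
      rw [this]
      simp [hF]
  rw [this]; rfl

theorem projZero_vertex (a : V) : projZero k V (vertex k a) = vertex k a := by
  simp [vertex, projZero_ofPath]

theorem comul_vertex (a : V) :
    CoalgebraStruct.comul (R := k) (vertex k a) = vertex k a ⊗ₜ[k] vertex k a := by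
  simp [vertex, comul_ofPath, comulPath, splits]

theorem projZero_of_mem {z : PathCoalgebra k V} (hz : z ∈ degreePart k V 1) :
    projZero k V z = 0 := by
  have : degreePart k V 1 ≤ LinearMap.ker (projZero k V) := by
    refine Submodule.span_le.2 ?_
    rintro _ ⟨a, b, p, hp, rfl⟩
    simp [projZero_ofPath, hp]
  exact this hz

theorem vertex_mem (a : V) : vertex k a ∈ degreePart k V 0 :=
  Submodule.subset_span ⟨a, a, .nil, rfl, rfl⟩

/-- In degree one, the comultiplication is `δ_L + δ_R`. -/
theorem comul_of_mem {z : PathCoalgebra k V} (hz : z ∈ degreePart k V 1) :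
    CoalgebraStruct.comul (R := k) z = leftCoaction k V z + rightCoaction k V z := by
  have : degreePart k V 1 ≤ LinearMap.eqLocus (CoalgebraStruct.comul (R := k))
      (leftCoaction k V + rightCoaction k V) := by
    refine Submodule.span_le.2 ?_
    rintro _ ⟨a, b, p, hp, rfl⟩
    change CoalgebraStruct.comul (R := k) (ofPath k p) =
      leftCoaction k V (ofPath k p) + rightCoaction k V (ofPath k p)
    rw [leftCoaction_ofPath, rightCoaction_ofPath, comul_ofPath, comulPath]
    cases p with
    | nil => simp at hp
    | cons p e =>
      cases p with
      | nil => simp [splits, vertex]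
      | cons p f => simp at hp
  exact this hz

/-- The isotypic components consist of the skew-primitive elements of degree one. -/
theorem mem_isotypic_iff {y x : V} {z : PathCoalgebra k V} :
    z ∈ isotypic k y x ↔ z ∈ degreePart k V 1 ∧
      CoalgebraStruct.comul (R := k) z = vertex k y ⊗ₜ[k] z + z ⊗ₜ[k] vertex k x := by
  constructor
  · rintro ⟨h1, h2, h3⟩
    exact ⟨h1, by rw [comul_of_mem k h1, h2, h3]⟩
  · rintro ⟨h1, h2⟩
    refine ⟨h1, ?_, ?_⟩
    · rw [leftCoaction_eq, h2]
      simp [projZero_vertex, projZero_of_mem k h1]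
    · rw [rightCoaction_eq, h2]
      simp [projZero_vertex, projZero_of_mem k h1]

end PathCoalgebra

/-! ### Graded Hopf algebra structures on a path coalgebra -/

section Structures

/-- A graded Hopf algebra structure on the path coalgebra `kQ`: a bilinear multiplication, a unit
and an antipode which, together with the given comultiplication and counit of `kQ`, form a Hopf
algebra that is graded by the length of paths. -/
structure GradedHopfStructure (k : Type u) [Field k] (V : Type v) [Quiver.{0} V] where
  mul : PathCoalgebra k V →ₗ[k] PathCoalgebra k V →ₗ[k] PathCoalgebra k V
  one : PathCoalgebra k V
  antipode : PathCoalgebra k V →ₗ[k] PathCoalgebra k V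
  mul_assoc : ∀ a b c, mul (mul a b) c = mul a (mul b c)
  one_mul : ∀ a, mul one a = a
  mul_one : ∀ a, mul a one = a
  counit_one : CoalgebraStruct.counit (R := k) one = 1
  counit_mul : ∀ a b, CoalgebraStruct.counit (R := k) (mul a b) =
    CoalgebraStruct.counit (R := k) a * CoalgebraStruct.counit (R := k) b
  comul_one : CoalgebraStruct.comul (R := k) one = one ⊗ₜ[k] one
  comul_mul : ∀ a b, CoalgebraStruct.comul (R := k) (mul a b) =
    TensorProduct.map₂ mul mul (CoalgebraStruct.comul (R := k) a)
      (CoalgebraStruct.comul (R := k) b)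
  mul_antipode_rTensor_comul : ∀ a,
    TensorProduct.lift mul (antipode.rTensor _ (CoalgebraStruct.comul (R := k) a)) =
      CoalgebraStruct.counit (R := k) a • one
  mul_antipode_lTensor_comul : ∀ a,
    TensorProduct.lift mul (antipode.lTensor _ (CoalgebraStruct.comul (R := k) a)) =
      CoalgebraStruct.counit (R := k) a • one
  one_mem : one ∈ degreePart k V 0
  mul_mem : ∀ m n a b, a ∈ degreePart k V m → b ∈ degreePart k V n →
    mul a b ∈ degreePart k V (m + n)
  antipode_mem : ∀ n a, a ∈ degreePart k V n → antipode a ∈ degreePart k V n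

namespace GradedHopfStructure

variable {k : Type u} [Field k] {V : Type v} [Quiver.{0} V]

/-- The path coalgebra, with the Hopf algebra structure `H`. -/
def Carrier (_H : GradedHopfStructure k V) : Type (max u v) := PathCoalgebra k V

variable (H : GradedHopfStructure k V)

instance : AddCommGroup H.Carrier := inferInstanceAs (AddCommGroup (PathCoalgebra k V))

instance : Module k H.Carrier := inferInstanceAs (Module k (PathCoalgebra k V))

instance : Coalgebra k H.Carrier := inferInstanceAs (Coalgebra k (PathCoalgebra k V))

instance : Ring H.Carrier where
  __ := (inferInstance : AddCommGroup H.Carrier)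
  mul a b := H.mul a b
  one := H.one
  mul_assoc := H.mul_assoc
  one_mul := H.one_mul
  mul_one := H.mul_one
  left_distrib a b c := map_add (H.mul a) b c
  right_distrib a b c := LinearMap.map_add₂ H.mul a b c
  zero_mul a := LinearMap.map_zero₂ H.mul a
  mul_zero a := map_zero (H.mul a)

instance : Algebra k H.Carrier :=
  Algebra.ofModule (fun c a b => LinearMap.map_smul₂ H.mul c a b)
    (fun c a b => map_smul (H.mul a) c b)

theorem map₂_mul_eq (x y : H.Carrier ⊗[k] H.Carrier) :
    TensorProduct.map₂ (LinearMap.mul k H.Carrier) (LinearMap.mul k H.Carrier) x y = x * y := by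
  induction x with
  | zero => simp
  | add x x' hx hx' => rw [map_add, LinearMap.add_apply, hx, hx', add_mul]
  | tmul a b =>
    induction y with
    | zero => simp
    | add y y' hy hy' => rw [map_add, hy, hy', mul_add]
    | tmul c d => simp

instance : Bialgebra k H.Carrier :=
  { (inferInstance : Algebra k H.Carrier), (inferInstance : Coalgebra k H.Carrier) with
    counit_one := H.counit_one
    mul_compr₂_counit := by
      ext a b
      exact H.counit_mul a b
    comul_one := H.comul_one
    mul_compr₂_comul := by
      ext a b
      exact (H.comul_mul a b).trans (H.map₂_mul_eq _ _) }

/-- `H` makes the path coalgebra a Hopf algebra. -/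
instance : HopfAlgebra k H.Carrier where
  antipode := H.antipode
  mul_antipode_rTensor_comul := by
    ext a
    refine (H.mul_antipode_rTensor_comul a).trans ?_
    exact (Algebra.algebraMap_eq_smul_one (A := H.Carrier) _).symm
  mul_antipode_lTensor_comul := by
    ext a
    refine (H.mul_antipode_lTensor_comul a).trans ?_
    exact (Algebra.algebraMap_eq_smul_one (A := H.Carrier) _).symm

end GradedHopfStructure

end Structures

/-! ### Hopf quivers -/

section HopfQuiver

variable {G : Type v} [Group G]

/-- The Hopf quiver of the group `G` and the ramification data `r = ∑ r_C C`. Its vertices are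
the elements of `G`. -/
def HopfQuiver (_r : ConjClasses G → ℕ) : Type v := G

/-- There are `r_C` arrows from `x` to `c x`, for each `x` in `G` and each `c` in the conjugacy
class `C`; that is, the arrows from `x` to `y` are numbered by `r_C`, where `C` is the class of
`y x⁻¹`. -/
instance (r : ConjClasses G → ℕ) : Quiver.{0} (HopfQuiver r) where
  Hom x y := Fin (r (ConjClasses.mk ((show G from y) * (show G from x)⁻¹)))

variable (k : Type u) [Field k]

/-- A graded Hopf algebra structure on the path coalgebra `kQ` of the Hopf quiver `Q` of `G`, in
which the vertices multiply as the elements of the group `G`; that is, `kQ₀` is the group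
algebra of `G`. -/
structure GradedHopfStructureOver (r : ConjClasses G → ℕ) extends
    GradedHopfStructure k (HopfQuiver r) where
  one_eq_vertex : one = vertex k (V := HopfQuiver r) (1 : G)
  mul_vertex : ∀ x y : G, mul (vertex k (V := HopfQuiver r) x) (vertex k (V := HopfQuiver r) y) =
    vertex k (V := HopfQuiver r) (x * y)

namespace GradedHopfStructureOver

variable {k} {r : ConjClasses G → ℕ}

/-- The Hopf algebra `kQ`, with the Hopf algebra structure `H`. -/
abbrev Carrier (H : GradedHopfStructureOver k r) : Type (max u v) :=
  H.toGradedHopfStructure.Carrier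

/-- An element of the group `G`, as a vertex in the Hopf algebra `kQ`. -/
def grp (H : GradedHopfStructureOver k r) (g : G) : H.Carrier := vertex k (V := HopfQuiver r) g

theorem grp_one (H : GradedHopfStructureOver k r) : H.grp 1 = 1 := H.one_eq_vertex.symm

theorem grp_mul (H : GradedHopfStructureOver k r) (x y : G) :
    H.grp (x * y) = H.grp x * H.grp y := (H.mul_vertex x y).symm

/-- `kQₙ`, in the Hopf algebra `kQ`. -/
def degree (H : GradedHopfStructureOver k r) (n : ℕ) : Submodule k H.Carrier :=
  degreePart k (HopfQuiver r) n

/-- Two graded Hopf algebra structures on `kQ` are isomorphic if there is an isomorphism of graded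
Hopf algebras between them that is the identity on the group `G` of vertices. -/
def Isomorphic (H H' : GradedHopfStructureOver k r) : Prop :=
  ∃ f : H.Carrier ≃ₐc[k] H'.Carrier,
    (∀ n x, x ∈ H.degree n ↔ f x ∈ H'.degree n) ∧ ∀ g, f (H.grp g) = H'.grp g

/-- Isomorphism of graded Hopf algebra structures on `kQ`. -/
instance isoSetoid (k : Type u) [Field k] (r : ConjClasses G → ℕ) :
    Setoid (GradedHopfStructureOver k r) where
  r := Isomorphic
  iseqv :=
    { refl := fun H => ⟨BialgEquiv.refl k H.Carrier, fun _ _ => Iff.rfl, fun _ => rfl⟩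
      symm := by
        rintro H H' ⟨f, h1, h2⟩
        refine ⟨f.symm, fun n x => ?_, fun g => ?_⟩
        · rw [h1 n, BialgEquiv.apply_symm_apply]
        · rw [← h2 g, BialgEquiv.symm_apply_apply]
      trans := by
        rintro H H' H'' ⟨f, h1, h2⟩ ⟨f', h1', h2'⟩
        exact ⟨f.trans f', fun n x => (h1 n x).trans (h1' n _), fun g =>
          (congrArg f' (h2 g)).trans (h2' g)⟩ }

variable (H : GradedHopfStructureOver k r)

/-- The isotypic component `ᵘ(kQ₁)¹`, for `u` in `G`. -/
def component (u : G) : Submodule k H.Carrier :=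
  isotypic k (V := HopfQuiver r) u (1 : G)

theorem mem_component_iff {u : G} {m : H.Carrier} :
    m ∈ H.component u ↔ m ∈ H.degree 1 ∧
      Coalgebra.comul (R := k) m = H.grp u ⊗ₜ[k] m + m ⊗ₜ[k] H.grp 1 :=
  mem_isotypic_iff k

theorem comul_grp (g : G) : Coalgebra.comul (R := k) (H.grp g) = H.grp g ⊗ₜ[k] H.grp g :=
  comul_vertex k _

theorem mul_mem_degree {m n : ℕ} {a b : H.Carrier} (ha : a ∈ H.degree m) (hb : b ∈ H.degree n) :
    a * b ∈ H.degree (m + n) := H.mul_mem m n a b ha hb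

theorem grp_mem (g : G) : H.grp g ∈ H.degree 0 := vertex_mem k _

theorem conj_mem {u z : G} (hz : z ∈ Subgroup.centralizer {u}) {m : H.Carrier}
    (hm : m ∈ H.component u) : H.grp z⁻¹ * m * H.grp z ∈ H.component u := by
  rw [mem_component_iff] at hm ⊢
  obtain ⟨h1, h2⟩ := hm
  constructor
  · simpa using H.mul_mem_degree (H.mul_mem_degree (H.grp_mem z⁻¹) h1) (H.grp_mem z)
  · have hu : z⁻¹ * u * z = u := by
      rw [mul_assoc, ← Subgroup.mem_centralizer_singleton_iff.1 hz]
      simp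
    simp only [Bialgebra.comul_mul, comul_grp, h2, mul_add, add_mul,
      Algebra.TensorProduct.tmul_mul_tmul, ← grp_mul, hu]
    simp

/-- The endomorphism `m ↦ z⁻¹ m z` of `ᵘ(kQ₁)¹`, for `z` in the centralizer of `u`. -/
def conjEnd (u : G) (z : Subgroup.centralizer {u}) : Module.End k (H.component u) :=
  LinearMap.restrict (LinearMap.mulRight k (H.grp z) ∘ₗ LinearMap.mulLeft k (H.grp (z : G)⁻¹))
    (fun _ hm => H.conj_mem z.2 hm)

theorem conjEnd_apply (u : G) (z : Subgroup.centralizer {u}) (m : H.component u) :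
    (H.conjEnd u z m : H.Carrier) = H.grp (z : G)⁻¹ * m * H.grp z := rfl

/-- The right action of the centralizer of `u` on `ᵘ(kQ₁)¹`. -/
def rightAction (u : G) : Subgroup.centralizer {u} →* (Module.End k (H.component u))ᵐᵒᵖ where
  toFun z := MulOpposite.op (H.conjEnd u z)
  map_one' := by
    apply MulOpposite.unop_injective
    ext m
    simp [conjEnd_apply, grp_one]
  map_mul' z z' := by
    apply MulOpposite.unop_injective
    ext m
    simp [conjEnd_apply, grp_mul, mul_assoc]

/-- The right action of the group algebra `k Z` on `ᵘ(kQ₁)¹`, where `Z` is the centralizer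
of `u`. -/
def rightActionAlg (u : G) :
    (MonoidAlgebra k (Subgroup.centralizer {u}))ᵐᵒᵖ →ₐ[k] Module.End k (H.component u) :=
  AlgHom.opComm (MonoidAlgebra.lift k _ _ (H.rightAction u))

/-- `ᵘ(kQ₁)¹` is a right `k Z`-module (a module over the opposite algebra), where `Z` is the
centralizer of `u` and `m · z = z⁻¹ m z`. -/
instance componentModule (u : G) :
    Module (MonoidAlgebra k (Subgroup.centralizer {u}))ᵐᵒᵖ (H.component u) :=
  Module.compHom _ (H.rightActionAlg u).toRingHom

theorem op_single_smul (u : G) (z : Subgroup.centralizer {u}) (c : k) (m : H.component u) :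
    ((MulOpposite.op (MonoidAlgebra.single z c) • m : H.component u) : H.Carrier) =
      c • (H.grp (z : G)⁻¹ * m * H.grp z) := by
  change ((H.rightActionAlg u (MulOpposite.op (MonoidAlgebra.single z c)) m : H.component u) :
    H.Carrier) = _
  simp [rightActionAlg, rightAction, conjEnd_apply]

instance (u : G) : IsScalarTower k (MonoidAlgebra k (Subgroup.centralizer {u}))ᵐᵒᵖ
    (H.component u) where
  smul_assoc c a m := by
    change H.rightActionAlg u (c • a) m = c • H.rightActionAlg u a m
    rw [map_smul]; rfl

end GradedHopfStructureOver

/-- A collection `{M_C}`, indexed by the conjugacy classes of `G`, where `M_C` is a right module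
of dimension `r_C` over the group algebra `k Z` of the centralizer `Z` of the chosen
element `rep C`. -/
structure ModuleCollection (rep : ConjClasses G → G) (r : ConjClasses G → ℕ) where
  M : ConjClasses G → Type w
  [addCommGroup : ∀ C, AddCommGroup (M C)]
  [moduleField : ∀ C, Module k (M C)]
  [module : ∀ C, Module (MonoidAlgebra k (Subgroup.centralizer {rep C}))ᵐᵒᵖ (M C)]
  [isScalarTower : ∀ C,
    IsScalarTower k (MonoidAlgebra k (Subgroup.centralizer {rep C}))ᵐᵒᵖ (M C)]
  rank_eq : ∀ C, Module.rank k (M C) = r C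

namespace ModuleCollection

attribute [instance] addCommGroup moduleField module isScalarTower

variable {k}

/-- Two collections are isomorphic if their members are, for each conjugacy class. -/
instance isoSetoid (k : Type u) [Field k] (rep : ConjClasses G → G) (r : ConjClasses G → ℕ) :
    Setoid (ModuleCollection.{u, v, w} k rep r) where
  r N N' := ∀ C, Nonempty
    (N.M C ≃ₗ[(MonoidAlgebra k (Subgroup.centralizer {rep C}))ᵐᵒᵖ] N'.M C)
  iseqv :=
    { refl := fun _ _ => ⟨LinearEquiv.refl _ _⟩
      symm := fun h C => (h C).map LinearEquiv.symm
      trans := fun h h' C => (h C).elim fun e => (h' C).map e.trans }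

end ModuleCollection

end HopfQuiver

end

end HopfQuivers

/-! Let V be the space spanned by the letters (c, i), graded by c in G. A path is a source together
with a word of letters, so kQ is T(V) ⊗ kG as a vector space, with degree one part V ⊗ kG. An
element of kQ is determined by its degree-zero part and by what results from splitting off the last
arrow of its paths (`eq_of_unconsLetter_eq`, `eq_of_splitArrow_eq`). The main identities follow from
this by induction on length.

Surjectivity. Given the modules M_C, choose for every c an element t_c that conjugates the
representative of its class to c, and let V_c be a copy of M_C. An element g maps V_c to V_{gcg⁻¹}
through the action of t_{gcg⁻¹}⁻¹ g t_c, which lies in the centralizer of the representative. This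
is an induced representation on V, and with the grading it is a Yetter-Drinfeld module (`letterRep`,
`letterRep_mem`). Any such module makes kQ a bialgebra under the quantum shuffle product `mulWord`:
splitting off the last arrow is a skew derivation of the product (`unconsLetter_wordMul`), and this
yields associativity and compatibility with Δ. The identity is convolution invertible because it is
so on kG and the error is locally nilpotent, which gives the antipode. The isotypic components of
the result are the given M_C (`componentEquiv`).

Injectivity. In any structure, kQ₁ is a Hopf bimodule over kG. Multiplication by group elements on
both sides carries each isotypic component to the one at a representative with source 1, uniquely up
to conjugation by the centralizer. So centralizer-linear isomorphisms of the components ᵘ(kQ₁)¹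
spread to a bimodule isomorphism in degree one (`transport_bimul`). Applied arrow by arrow, it
becomes a coalgebra automorphism of kQ. This is multiplicative because the product is determined
recursively by the bimodule kQ₁ (`splitArrow_mul`, `extendHom_mul`).

The map on isomorphism classes is well defined because the components consist of skew-primitives of
degree one, which isomorphisms fixing the vertices preserve (`Isomorphic.components`). -/

namespace HopfQuivers

noncomputable section

/-! ### The basis of `kQ` indexed by sources and words -/

section Words

variable {G : Type v} [Group G] (r : ConjClasses G → ℕ)

/-- The letters `(c, i)`: the arrows starting at any given vertex `x` are numbered by the letters,
`(c, i)` being an arrow from `x` to `c x`. -/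
abbrev Letter : Type v := Σ c : G, Fin (r (ConjClasses.mk c))

variable {r}

variable (r) in
/-- An element of `G`, as a vertex of the Hopf quiver. -/
def toVertex (x : G) : HopfQuiver r := x

/-- A vertex of the Hopf quiver, as an element of `G`. -/
def vertexVal (x : HopfQuiver r) : G := x

/-- The target of the path with source `x` that is described by a word; the head of the word is
the last arrow. -/
def wordTarget (x : G) : List (Letter r) → G
  | [] => x
  | a :: w => a.1 * wordTarget x w

/-- The word of a path. -/
def pathWord {x : HopfQuiver r} : {y : HopfQuiver r} → Quiver.Path x y → List (Letter r)
  | _, .nil => []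
  | z, .cons (b := y) p e => ⟨vertexVal z * (vertexVal y)⁻¹, e⟩ :: pathWord p

theorem length_pathWord {x y : HopfQuiver r} (p : Quiver.Path x y) :
    (pathWord p).length = p.length := by
  induction p with
  | nil => rfl
  | cons p e ih => simp [pathWord, ih]

theorem letter_ext {a b : Letter r} (h : a.1 = b.1) (h' : (a.2 : ℕ) = b.2) : a = b := by
  obtain ⟨c, i⟩ := a
  obtain ⟨d, j⟩ := b
  obtain rfl : c = d := h
  obtain rfl : i = j := Fin.ext h'
  rfl

/-- The arrow with source `y` that is described by the letter `a`. -/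
def letterArrow (a : Letter r) (y : G) : toVertex r y ⟶ toVertex r (a.1 * y) :=
  Fin.cast (congrArg (fun c => r (ConjClasses.mk c)) (mul_inv_cancel_right a.1 y).symm) a.2

theorem pathWord_cons_letterArrow {x : HopfQuiver r} {y : G} (p : Quiver.Path x (toVertex r y))
    (a : Letter r) : pathWord (p.cons (letterArrow a y)) = a :: pathWord p :=
  congrArg (· :: pathWord p) (letter_ext (mul_inv_cancel_right _ _) rfl)

/-- The path with a given source and word. -/
def wordPath (x : G) : (w : List (Letter r)) →
    Quiver.Path (toVertex r x) (toVertex r (wordTarget x w))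
  | [] => .nil
  | a :: w => (wordPath x w).cons (letterArrow a (wordTarget x w))

theorem pathWord_wordPath (x : G) (w : List (Letter r)) : pathWord (wordPath x w) = w := by
  induction w with
  | nil => rfl
  | cons a w ih => exact (pathWord_cons_letterArrow _ a).trans (congrArg _ ih)

theorem length_wordPath (x : G) (w : List (Letter r)) : (wordPath x w).length = w.length := by
  rw [← length_pathWord, pathWord_wordPath]

/-- Source and word determine the target, so the targets must be allowed to differ a priori: the
letter z y⁻¹ and the end y of the shorter path give back z. -/
theorem sigma_eq_of_pathWord_eq {x y y' : HopfQuiver r} (p : Quiver.Path x y)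
    (q : Quiver.Path x y') (h : pathWord p = pathWord q) :
    (⟨y, p⟩ : Σ z, Quiver.Path x z) = ⟨y', q⟩ := by
  induction p generalizing y' with
  | nil =>
    cases q with
    | nil => rfl
    | cons q f => simp [pathWord] at h
  | @cons b c p e ih =>
    cases q with
    | nil => simp [pathWord] at h
    | @cons b' _ q f =>
      simp only [pathWord, List.cons.injEq] at h
      obtain ⟨h1, h2⟩ := h
      have h3 := ih q h2
      cases h3
      have hc : c = y' := mul_right_cancel (G := G) (Sigma.mk.inj h1).1
      subst hc
      obtain rfl : e = f := eq_of_heq (Sigma.mk.inj h1).2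
      rfl

variable (r) in
/-- Paths are given by their source and their word. -/
def pathEquiv : AllPaths (HopfQuiver r) ≃ G × List (Letter r) :=
  Equiv.ofBijective (fun p => (vertexVal p.1, pathWord p.2.2)) <| by
    constructor
    · rintro ⟨x, y, p⟩ ⟨x', y', q⟩ h
      simp only [Prod.mk.injEq] at h
      obtain ⟨h1, h2⟩ := h
      obtain rfl : x = x' := h1
      have := sigma_eq_of_pathWord_eq p q h2
      obtain ⟨rfl, h⟩ := Sigma.mk.inj this
      rw [eq_of_heq h]
    · rintro ⟨x, w⟩
      exact ⟨⟨toVertex r x, _, wordPath x w⟩, Prod.ext rfl (pathWord_wordPath x w)⟩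

variable (k : Type u) [Field k]

variable (r) in
/-- The basis of `kQ` given by the paths, indexed by their source and word. -/
def wordBasis : Module.Basis (G × List (Letter r)) k (PathCoalgebra k (HopfQuiver r)) :=
  (pathBasis k (HopfQuiver r)).reindex (pathEquiv r)

variable (r) in
/-- The path with source `x` and word `w`, as an element of `kQ`. -/
def ofWord (x : G) (w : List (Letter r)) : PathCoalgebra k (HopfQuiver r) :=
  wordBasis r k (x, w)

theorem ofPath_eq {x y : HopfQuiver r} (p : Quiver.Path x y) :
    ofPath k p = ofWord r k (vertexVal x) (pathWord p) := by
  rw [ofWord, wordBasis, Module.Basis.reindex_apply]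
  have : (pathEquiv r).symm (vertexVal x, pathWord p) = ⟨x, y, p⟩ :=
    (Equiv.symm_apply_eq _).2 rfl
  rw [this]; rfl

theorem ofWord_eq (x : G) (w : List (Letter r)) : ofWord r k x w = ofPath k (wordPath x w) := by
  rw [ofPath_eq, pathWord_wordPath]; rfl

theorem ofWord_nil (x : G) : ofWord r k x [] = vertex k (toVertex r x) :=
  ofWord_eq k x []

variable {k} in
/-- Linear maps on `kQ` agree if they agree on the paths. -/
theorem hom_ext_ofWord {N : Type*} [AddCommMonoid N] [Module k N]
    {f g : PathCoalgebra k (HopfQuiver r) →ₗ[k] N}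
    (h : ∀ x w, f (ofWord r k x w) = g (ofWord r k x w)) : f = g :=
  (wordBasis r k).ext fun p => h p.1 p.2

variable {k} in
theorem induction_ofWord {p : PathCoalgebra k (HopfQuiver r) → Prop}
    (z : PathCoalgebra k (HopfQuiver r)) (zero : p 0) (add : ∀ z z', p z → p z' → p (z + z'))
    (smul : ∀ (b : k) z, p z → p (b • z)) (ofWord : ∀ x w, p (ofWord r k x w)) : p z := by
  have hz : z ∈ Submodule.span k (Set.range (wordBasis r k)) := by simp
  induction hz using Submodule.span_induction with
  | mem z hz =>
    obtain ⟨⟨x, w⟩, rfl⟩ := hz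
    exact ofWord x w
  | zero => exact zero
  | add z z' _ _ h h' => exact add z z' h h'
  | smul b z _ h => exact smul b z h

/-- The linear map on `kQ` with given values on the paths. -/
def wordLift {N : Type*} [AddCommMonoid N] [Module k N] (F : G → List (Letter r) → N) :
    PathCoalgebra k (HopfQuiver r) →ₗ[k] N :=
  (wordBasis r k).constr k fun p => F p.1 p.2

@[simp]
theorem wordLift_ofWord {N : Type*} [AddCommMonoid N] [Module k N]
    (F : G → List (Letter r) → N) (x : G) (w : List (Letter r)) :
    wordLift k F (ofWord r k x w) = F x w :=
  (wordBasis r k).constr_basis k _ _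

variable (r) in
/-- Prepending a combination of letters to the words. -/
def consLetter : (Letter r →₀ k) →ₗ[k]
    PathCoalgebra k (HopfQuiver r) →ₗ[k] PathCoalgebra k (HopfQuiver r) :=
  Finsupp.lift _ k _ fun a => wordLift k fun x w => ofWord r k x (a :: w)

@[simp]
theorem consLetter_single (a : Letter r) (x : G) (w : List (Letter r)) :
    consLetter r k (Finsupp.single a 1) (ofWord r k x w) = ofWord r k x (a :: w) := by
  simp [consLetter]

variable (r) in
/-- Splitting off the first letter of the words. -/
def unconsLetter : PathCoalgebra k (HopfQuiver r) →ₗ[k]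
    (Letter r →₀ k) ⊗[k] PathCoalgebra k (HopfQuiver r) :=
  wordLift k fun x w => match w with
    | [] => 0
    | a :: w => Finsupp.single a 1 ⊗ₜ ofWord r k x w

@[simp]
theorem unconsLetter_nil (x : G) : unconsLetter r k (ofWord r k x []) = 0 := by
  simp [unconsLetter]

@[simp]
theorem unconsLetter_cons (x : G) (a : Letter r) (w : List (Letter r)) :
    unconsLetter r k (ofWord r k x (a :: w)) = Finsupp.single a 1 ⊗ₜ ofWord r k x w := by
  simp [unconsLetter]

@[simp]
theorem unconsLetter_consLetter (m : Letter r →₀ k) (z : PathCoalgebra k (HopfQuiver r)) :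
    unconsLetter r k (consLetter r k m z) = m ⊗ₜ z := by
  have : (consLetter r k).compr₂ (unconsLetter r k) = TensorProduct.mk k _ _ := by
    refine Finsupp.lhom_ext' fun a => LinearMap.ext_ring ?_
    refine hom_ext_ofWord fun x w => ?_
    simp
  exact LinearMap.congr_fun₂ this m z

variable {k}

@[simp]
theorem projZero_nil (x : G) :
    projZero k (HopfQuiver r) (ofWord r k x []) = ofWord r k x [] := by
  rw [ofWord_nil, projZero_vertex]

@[simp]
theorem projZero_cons (x : G) (a : Letter r) (w : List (Letter r)) :
    projZero k (HopfQuiver r) (ofWord r k x (a :: w)) = 0 := by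
  simp [ofWord_eq, projZero_ofPath, length_wordPath]

@[simp]
theorem projZero_consLetter (m : Letter r →₀ k) (z : PathCoalgebra k (HopfQuiver r)) :
    projZero k (HopfQuiver r) (consLetter r k m z) = 0 := by
  have : (consLetter r k).compr₂ (projZero k (HopfQuiver r)) = 0 := by
    refine Finsupp.lhom_ext' fun a => LinearMap.ext_ring ?_
    refine hom_ext_ofWord fun x w => ?_
    simp
  exact LinearMap.congr_fun₂ this m z

/-- A path is either a vertex or a last letter placed on a shorter path; that is, kQ = kQ₀ ⊕ (V ⊗
kQ). -/
theorem projZero_add_cons_uncons (z : PathCoalgebra k (HopfQuiver r)) :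
    projZero k (HopfQuiver r) z + TensorProduct.lift (consLetter r k) (unconsLetter r k z) = z := by
  have : projZero k (HopfQuiver r) + TensorProduct.lift (consLetter r k) ∘ₗ unconsLetter r k =
      LinearMap.id := by
    refine hom_ext_ofWord fun x w => ?_
    cases w <;> simp
  exact LinearMap.congr_fun this z

theorem counit_nil (x : G) :
    CoalgebraStruct.counit (R := k) (ofWord r k x []) = 1 := by
  simp [ofWord_eq, counit_ofPath, length_wordPath]

theorem counit_cons (x : G) (a : Letter r) (w : List (Letter r)) :
    CoalgebraStruct.counit (R := k) (ofWord r k x (a :: w)) = 0 := by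
  simp [ofWord_eq, counit_ofPath, length_wordPath]

theorem counit_projZero (z : PathCoalgebra k (HopfQuiver r)) :
    CoalgebraStruct.counit (R := k) (projZero k (HopfQuiver r) z) =
      CoalgebraStruct.counit (R := k) z := by
  have : CoalgebraStruct.counit (R := k) ∘ₗ projZero k (HopfQuiver r) =
      CoalgebraStruct.counit (R := k) := by
    refine hom_ext_ofWord fun x w => ?_
    cases w <;> simp [counit_cons]
  exact LinearMap.congr_fun this z

theorem comul_nil (x : G) : CoalgebraStruct.comul (R := k) (ofWord r k x []) =
    ofWord r k x [] ⊗ₜ ofWord r k x [] := by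
  rw [ofWord_nil, comul_vertex]

theorem leftCoaction_ofWord (x : G) (w : List (Letter r)) :
    leftCoaction k (HopfQuiver r) (ofWord r k x w) =
      ofWord r k (wordTarget x w) [] ⊗ₜ ofWord r k x w := by
  rw [ofWord_eq, leftCoaction_ofPath, ofWord_nil]

theorem rightCoaction_ofWord (x : G) (w : List (Letter r)) :
    rightCoaction k (HopfQuiver r) (ofWord r k x w) =
      ofWord r k x w ⊗ₜ ofWord r k x [] := by
  rw [ofWord_eq, rightCoaction_ofPath, ofWord_nil]

/-- A split either cuts after the last arrow, leaving the target vertex on the left, or cuts the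
shorter path and keeps the last arrow on its left part. -/
theorem comul_cons (x : G) (a : Letter r) (w : List (Letter r)) :
    CoalgebraStruct.comul (R := k) (ofWord r k x (a :: w)) =
      ofWord r k (wordTarget x (a :: w)) [] ⊗ₜ ofWord r k x (a :: w) +
        (consLetter r k (Finsupp.single a 1)).rTensor _
          (CoalgebraStruct.comul (R := k) (ofWord r k x w)) := by
  rw [ofWord_eq k x (a :: w), ofWord_eq k x w, comul_ofPath, comul_ofPath, comulPath, comulPath,
    sum_map_eq]
  simp only [wordPath, splits, List.map_cons, List.sum_cons, List.map_map, Function.comp_def,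
    ofWord_nil]
  congr 1
  congr 2
  funext s
  rw [LinearMap.rTensor_tmul, ofPath_eq k s.2.1, consLetter_single]
  exact congrArg (· ⊗ₜ _) ((ofPath_eq k _).trans
    (congrArg _ (pathWord_cons_letterArrow s.2.1 a)))

/-- Basis-free form of `comul_cons`, needed when the last letter is a linear combination. -/
theorem comul_eq (z : PathCoalgebra k (HopfQuiver r)) :
    CoalgebraStruct.comul (R := k) z = leftCoaction k (HopfQuiver r) z +
      TensorProduct.lift (LinearMap.rTensorHom _ ∘ₗ consLetter r k)
        ((CoalgebraStruct.comul (R := k)).lTensor _ (unconsLetter r k z)) := by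
  have : CoalgebraStruct.comul (R := k) = leftCoaction k (HopfQuiver r) +
      TensorProduct.lift (LinearMap.rTensorHom _ ∘ₗ consLetter r k) ∘ₗ
        (CoalgebraStruct.comul (R := k)).lTensor _ ∘ₗ unconsLetter r k := by
    refine hom_ext_ofWord fun x w => ?_
    cases w <;> simp [comul_nil, comul_cons, leftCoaction_ofWord, wordTarget]
  exact LinearMap.congr_fun this z

theorem degreePart_eq (n : ℕ) : degreePart k (HopfQuiver r) n =
    Submodule.span k {z | ∃ x w, w.length = n ∧ z = ofWord r k x w} := by
  refine congrArg _ (Set.ext fun z => ⟨?_, ?_⟩)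
  · rintro ⟨x, y, p, hp, rfl⟩
    exact ⟨vertexVal x, pathWord p, by rw [length_pathWord, hp], ofPath_eq k p⟩
  · rintro ⟨x, w, hw, rfl⟩
    exact ⟨_, _, wordPath x w, by rw [length_wordPath, hw], ofWord_eq k x w⟩

theorem ofWord_mem (x : G) (w : List (Letter r)) :
    ofWord r k x w ∈ degreePart k (HopfQuiver r) w.length := by
  rw [degreePart_eq]
  exact Submodule.subset_span ⟨x, w, rfl, rfl⟩

theorem consLetter_mem (m : Letter r →₀ k) {n : ℕ} {z : PathCoalgebra k (HopfQuiver r)}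
    (hz : z ∈ degreePart k (HopfQuiver r) n) :
    consLetter r k m z ∈ degreePart k (HopfQuiver r) (n + 1) := by
  rw [degreePart_eq] at hz
  induction hz using Submodule.span_induction with
  | mem z hz =>
    obtain ⟨x, w, rfl, rfl⟩ := hz
    induction m using Finsupp.induction_linear with
    | zero => simp
    | add m m' h h' => simpa using add_mem h h'
    | single a c =>
      have : Finsupp.single a c = c • Finsupp.single a (1 : k) := by simp
      rw [this, map_smul, LinearMap.smul_apply, consLetter_single]
      exact Submodule.smul_mem _ _ (ofWord_mem x (a :: w))
  | zero => simp
  | add z z' _ _ h h' => simpa using add_mem h h'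
  | smul c z _ h => simpa using Submodule.smul_mem _ _ h

/-- The `(y, x)`-isotypic component is spanned by the arrows from `x` to `y`. -/
theorem isotypic_eq (y x : G) : isotypic k (toVertex r y) (toVertex r x) =
    Submodule.span k {z | ∃ a : Letter r, a.1 * x = y ∧ z = ofWord r k x [a]} := by
  apply le_antisymm
  · intro z hz
    obtain ⟨h1, h2, h3⟩ := hz
    classical
    let P : PathCoalgebra k (HopfQuiver r) →ₗ[k] PathCoalgebra k (HopfQuiver r) :=
      wordLift k fun x' w => if x' = x ∧ wordTarget x' w = y ∧ w.length = 1
        then ofWord r k x' w else 0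
    -- `S g` is applied only to the vertex leg of a coaction, where it is the functional dual to g.
    -- Hence `L` keeps the paths with target y and `R` those with source x; both fix `z`, and in
    -- degree one their composite is `P`.
    let S : G → PathCoalgebra k (HopfQuiver r) →ₗ[k] k :=
      fun g => wordLift k fun x' w => if x' = g then 1 else 0
    let L : PathCoalgebra k (HopfQuiver r) →ₗ[k] PathCoalgebra k (HopfQuiver r) :=
      (TensorProduct.lid k _).toLinearMap ∘ₗ (S y).rTensor _ ∘ₗ leftCoaction k (HopfQuiver r)
    let R : PathCoalgebra k (HopfQuiver r) →ₗ[k] PathCoalgebra k (HopfQuiver r) :=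
      (TensorProduct.rid k _).toLinearMap ∘ₗ (S x).lTensor _ ∘ₗ rightCoaction k (HopfQuiver r)
    have hL : L z = z := by
      simp [L, h2, S, ← ofWord_nil]
    have hR : R z = z := by
      simp [R, h3, S, ← ofWord_nil]
    have key : ∀ z ∈ degreePart k (HopfQuiver r) 1, R (L z) = P z := by
      intro z hz
      rw [degreePart_eq] at hz
      induction hz using Submodule.span_induction with
      | mem z hz =>
        obtain ⟨x', w, hw, rfl⟩ := hz
        have hL : L (ofWord r k x' w) = if wordTarget x' w = y then ofWord r k x' w else 0 := by
          simp [L, S, leftCoaction_ofWord]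
        have hR : R (ofWord r k x' w) = if x' = x then ofWord r k x' w else 0 := by
          simp [R, S, rightCoaction_ofWord]
        rw [hL]
        split_ifs with hy
        · simp [hR, P, hy, hw]
        · simp [P, hy]
      | zero => simp
      | add z z' _ _ h h' => simp only [map_add, h, h']
      | smul c z _ h => simp only [map_smul, h]
    have hz : z = P z := by rw [← key z h1, hL, hR]
    rw [hz]
    have : LinearMap.range P ≤ Submodule.span k
        {z | ∃ a : Letter r, a.1 * x = y ∧ z = ofWord r k x [a]} := by
      rw [LinearMap.range_eq_map, ← (wordBasis r k).span_eq, Submodule.map_span,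
        Submodule.span_le]
      rintro _ ⟨_, ⟨⟨x', w⟩, rfl⟩, rfl⟩
      change P (ofWord r k x' w) ∈ _
      simp only [P, wordLift_ofWord]
      split_ifs with h
      · obtain ⟨rfl, rfl, h⟩ := h
        obtain ⟨a, rfl⟩ := List.length_eq_one_iff.1 h
        exact Submodule.subset_span ⟨a, rfl, rfl⟩
      · exact zero_mem _
    exact this ⟨z, rfl⟩
  · rw [Submodule.span_le]
    rintro _ ⟨a, rfl, rfl⟩
    refine ⟨ofWord_mem x [a], ?_, ?_⟩
    · rw [leftCoaction_ofWord, ← ofWord_nil]; rfl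
    · rw [rightCoaction_ofWord, ← ofWord_nil]

end Words

end

end HopfQuivers

namespace HopfQuivers

noncomputable section

/-! ### The multiplication given by a Yetter-Drinfeld structure on the letters -/

section Multiplication

variable {k : Type u} [Field k] {G : Type v} [Group G] {r : ConjClasses G → ℕ}

variable (k r) in
/-- The span of the paths with target `g`. -/
def targetPart (g : G) : Submodule k (PathCoalgebra k (HopfQuiver r)) :=
  Submodule.span k {z | ∃ x w, wordTarget x w = g ∧ z = ofWord r k x w}

theorem ofWord_mem_targetPart (x : G) (w : List (Letter r)) :
    ofWord r k x w ∈ targetPart k r (wordTarget x w) :=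
  Submodule.subset_span ⟨x, w, rfl, rfl⟩

variable (k r) in
/-- The combinations of letters of degree `c`. -/
abbrev letterPart (c : G) : Submodule k (Letter r →₀ k) :=
  Finsupp.supported k k {a | a.1 = c}

theorem single_mem_letterPart (a : Letter r) : Finsupp.single a (1 : k) ∈ letterPart k r a.1 :=
  Finsupp.single_mem_supported k 1 rfl

theorem consLetter_mem_targetPart {c g : G} {m : Letter r →₀ k} (hm : m ∈ letterPart k r c)
    {z : PathCoalgebra k (HopfQuiver r)} (hz : z ∈ targetPart k r g) :
    consLetter r k m z ∈ targetPart k r (c * g) := by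
  induction hz using Submodule.span_induction with
  | mem z hz =>
    obtain ⟨x, w, rfl, rfl⟩ := hz
    rw [letterPart, Finsupp.supported_eq_span_single] at hm
    induction hm using Submodule.span_induction with
    | mem m hm =>
      obtain ⟨a, rfl, rfl⟩ := hm
      rw [consLetter_single]
      exact ofWord_mem_targetPart x (a :: w)
    | zero => simp
    | add m m' _ _ h h' => simpa using add_mem h h'
    | smul b m _ h => simpa using Submodule.smul_mem _ b h
  | zero => simp
  | add z z' _ _ h h' => simpa using add_mem h h'
  | smul b z _ h => simpa using Submodule.smul_mem _ b h

theorem leftCoaction_of_mem {g : G} {z : PathCoalgebra k (HopfQuiver r)}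
    (hz : z ∈ targetPart k r g) :
    leftCoaction k (HopfQuiver r) z = ofWord r k g [] ⊗ₜ z := by
  induction hz using Submodule.span_induction with
  | mem z hz =>
    obtain ⟨x, w, rfl, rfl⟩ := hz
    exact leftCoaction_ofWord x w
  | zero => simp
  | add z z' _ _ h h' => rw [map_add, h, h', TensorProduct.tmul_add]
  | smul b z _ h => rw [map_smul, h, TensorProduct.tmul_smul]

/-- The principle behind the inductions on length: only the vertices are lost when the last letter
is split off. -/
theorem eq_of_unconsLetter_eq {z z' : PathCoalgebra k (HopfQuiver r)}
    (h : unconsLetter r k z = unconsLetter r k z')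
    (h' : projZero k (HopfQuiver r) z = projZero k (HopfQuiver r) z') : z = z' := by
  rw [← projZero_add_cons_uncons z, ← projZero_add_cons_uncons z', h, h']

theorem eq_of_rTensor_unconsLetter_eq
    {X X' : PathCoalgebra k (HopfQuiver r) ⊗[k] PathCoalgebra k (HopfQuiver r)}
    (h : (unconsLetter r k).rTensor _ X = (unconsLetter r k).rTensor _ X')
    (h' : (projZero k (HopfQuiver r)).rTensor _ X = (projZero k (HopfQuiver r)).rTensor _ X') :
    X = X' := by
  have key : ∀ X : PathCoalgebra k (HopfQuiver r) ⊗[k] PathCoalgebra k (HopfQuiver r),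
      (projZero k (HopfQuiver r)).rTensor _ X +
        (TensorProduct.lift (consLetter r k)).rTensor _ ((unconsLetter r k).rTensor _ X) = X := by
    intro X
    induction X with
    | zero => simp
    | add X X' h h' =>
      conv_rhs => rw [← h, ← h']
      simp only [map_add]
      abel
    | tmul z z' =>
      simp only [LinearMap.rTensor_tmul]
      rw [← TensorProduct.add_tmul, projZero_add_cons_uncons]
  rw [← key X, ← key X', h, h']

variable (ρ : Representation k G (Letter r →₀ k))

/-- The product of the paths `(x, w)` and `(y, v)`. -/
def mulWord (x y : G) : List (Letter r) → List (Letter r) → PathCoalgebra k (HopfQuiver r)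
  | [], [] => ofWord r k (x * y) []
  | [], b :: v => consLetter r k (ρ x (Finsupp.single b 1)) (mulWord x y [] v)
  | a :: w, [] => consLetter r k (Finsupp.single a 1) (mulWord x y w [])
  -- Quantum shuffle: the last arrow of the product comes from the left factor, or from the right
  -- one, in which case it passes the whole left path and is acted on by the target of that path.
  | a :: w, b :: v => consLetter r k (Finsupp.single a 1) (mulWord x y w (b :: v)) +
      consLetter r k (ρ (wordTarget x (a :: w)) (Finsupp.single b 1)) (mulWord x y (a :: w) v)
  termination_by w v => w.length + v.length

/-- The multiplication of `kQ`. -/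
def wordMul : PathCoalgebra k (HopfQuiver r) →ₗ[k] PathCoalgebra k (HopfQuiver r) →ₗ[k]
    PathCoalgebra k (HopfQuiver r) :=
  wordLift k fun x w => wordLift k fun y v => mulWord ρ x y w v

theorem wordMul_ofWord (x y : G) (w v : List (Letter r)) :
    wordMul ρ (ofWord r k x w) (ofWord r k y v) = mulWord ρ x y w v := by
  simp [wordMul]

@[simp]
theorem wordMul_nil_nil (x y : G) :
    wordMul ρ (ofWord r k x []) (ofWord r k y []) = ofWord r k (x * y) [] := by
  rw [wordMul_ofWord, mulWord]

theorem one_wordMul (z : PathCoalgebra k (HopfQuiver r)) :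
    wordMul ρ (ofWord r k 1 []) z = z := by
  suffices h : wordMul ρ (ofWord r k 1 []) = LinearMap.id from LinearMap.congr_fun h z
  refine hom_ext_ofWord fun y v => ?_
  rw [wordMul_ofWord, LinearMap.id_apply]
  induction v with
  | nil => rw [mulWord, one_mul]
  | cons b v ih => rw [mulWord, ih, map_one, Module.End.one_apply, consLetter_single]

theorem mulWord_nil_right (x y : G) (w : List (Letter r)) :
    mulWord ρ x y w [] = ofWord r k (x * y) w := by
  induction w with
  | nil => rw [mulWord]
  | cons b v ih => rw [mulWord, ih, consLetter_single]

theorem wordMul_one (z : PathCoalgebra k (HopfQuiver r)) :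
    wordMul ρ z (ofWord r k 1 []) = z := by
  suffices h : (wordMul ρ).flip (ofWord r k 1 []) = LinearMap.id from LinearMap.congr_fun h z
  refine hom_ext_ofWord fun y v => ?_
  rw [LinearMap.flip_apply, wordMul_ofWord, mulWord_nil_right, mul_one, LinearMap.id_apply]

theorem mulWord_mem (x y : G) (w v : List (Letter r)) :
    mulWord ρ x y w v ∈ degreePart k (HopfQuiver r) (w.length + v.length) := by
  induction w generalizing v with
  | nil =>
    induction v with
    | nil => rw [mulWord]; exact ofWord_mem (r := r) (x * y) []
    | cons b v ih => rw [mulWord]; exact consLetter_mem _ ih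
  | cons a w ih =>
    induction v with
    | nil => rw [mulWord]; exact consLetter_mem _ (ih [])
    | cons b v ih' =>
      rw [mulWord]
      refine add_mem ?_ (consLetter_mem _ ih')
      have := consLetter_mem (Finsupp.single a 1) (ih (b :: v))
      rwa [Nat.add_right_comm] at this

theorem wordMul_mem {m n : ℕ} {z z' : PathCoalgebra k (HopfQuiver r)}
    (hz : z ∈ degreePart k (HopfQuiver r) m) (hz' : z' ∈ degreePart k (HopfQuiver r) n) :
    wordMul ρ z z' ∈ degreePart k (HopfQuiver r) (m + n) := by
  rw [degreePart_eq] at hz hz'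
  induction hz, hz' using Submodule.span_induction₂ with
  | mem_mem z z' hz hz' =>
    obtain ⟨x, w, rfl, rfl⟩ := hz
    obtain ⟨y, v, rfl, rfl⟩ := hz'
    rw [wordMul_ofWord]
    exact mulWord_mem ρ x y w v
  | zero_left => simp
  | zero_right => simp
  | add_left _ _ _ _ _ _ h h' => simpa using add_mem h h'
  | add_right _ _ _ _ _ _ h h' => simpa using add_mem h h'
  | smul_left _ _ _ _ _ h => simpa using Submodule.smul_mem _ _ h
  | smul_right _ _ _ _ _ h => simpa using Submodule.smul_mem _ _ h

theorem projZero_wordMul (z z' : PathCoalgebra k (HopfQuiver r)) :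
    projZero k (HopfQuiver r) (wordMul ρ z z') =
      wordMul ρ (projZero k (HopfQuiver r) z) (projZero k (HopfQuiver r) z') := by
  suffices h : (wordMul ρ).compr₂ (projZero k (HopfQuiver r)) =
      (wordMul ρ).compl₁₂ (projZero k (HopfQuiver r)) (projZero k (HopfQuiver r)) from
    LinearMap.congr_fun₂ h z z'
  refine hom_ext_ofWord fun x w => hom_ext_ofWord fun y v => ?_
  simp only [LinearMap.compr₂_apply, LinearMap.compl₁₂_apply, wordMul_ofWord]
  cases w <;> cases v <;> rw [mulWord] <;> simp

theorem counit_wordMul (z z' : PathCoalgebra k (HopfQuiver r)) :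
    CoalgebraStruct.counit (R := k) (wordMul ρ z z') =
      CoalgebraStruct.counit (R := k) z * CoalgebraStruct.counit (R := k) z' := by
  suffices h : (wordMul ρ).compr₂ (CoalgebraStruct.counit (R := k)) =
      (LinearMap.mul k k).compl₁₂ (CoalgebraStruct.counit (R := k))
        (CoalgebraStruct.counit (R := k)) from
    LinearMap.congr_fun₂ h z z'
  refine hom_ext_ofWord fun x w => hom_ext_ofWord fun y v => ?_
  simp only [LinearMap.compr₂_apply, LinearMap.compl₁₂_apply, LinearMap.mul_apply']
  rw [← counit_projZero, projZero_wordMul]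
  cases w <;> cases v <;> simp [counit_nil, counit_cons]

/-- The recursion of `mulWord` as a skew Leibniz rule. All four cases are covered, since vertices
are killed; the left factor needs a single target for the twist by `ρ g` to make sense. -/
theorem unconsLetter_wordMul {g : G} {z : PathCoalgebra k (HopfQuiver r)}
    (hz : z ∈ targetPart k r g) (z' : PathCoalgebra k (HopfQuiver r)) :
    unconsLetter r k (wordMul ρ z z') = ((wordMul ρ).flip z').lTensor _ (unconsLetter r k z) +
      TensorProduct.map (ρ g) (wordMul ρ z) (unconsLetter r k z') := by
  induction hz using Submodule.span_induction with
  | mem z hz =>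
    obtain ⟨x, w, rfl, rfl⟩ := hz
    induction z' using induction_ofWord with
    | zero => simp
    | add z₁ z₂ h₁ h₂ =>
      simp only [map_add, LinearMap.lTensor_add, LinearMap.add_apply, h₁, h₂]
      abel
    | smul b z h =>
      simp only [map_smul, LinearMap.lTensor_smul, LinearMap.smul_apply, h, smul_add]
    | ofWord y v =>
      rw [wordMul_ofWord]
      cases w <;> cases v <;> rw [mulWord] <;> simp [wordMul_ofWord, wordTarget]
  | zero => simp
  | add z₁ z₂ _ _ h₁ h₂ =>
    simp only [map_add, LinearMap.add_apply, h₁, h₂, TensorProduct.map_add_right]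
    abel
  | smul b z _ h =>
    simp only [map_smul, LinearMap.smul_apply, h, TensorProduct.map_smul_right, smul_add]

variable (hρ : ∀ g a, ρ g (Finsupp.single a 1) ∈ letterPart k r (g * a.1 * g⁻¹))
include hρ

/-- The Yetter-Drinfeld condition makes targets multiply: a letter of degree b that passes a path
with target g gets degree g b g⁻¹, and (g b g⁻¹)(g h) = g (b h). -/
theorem mulWord_mem_targetPart (x y : G) (w v : List (Letter r)) :
    mulWord ρ x y w v ∈ targetPart k r (wordTarget x w * wordTarget y v) := by
  induction w generalizing v with
  | nil =>
    induction v with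
    | nil => rw [mulWord]; exact ofWord_mem_targetPart (r := r) (x * y) []
    | cons b v ih =>
      rw [mulWord]
      convert consLetter_mem_targetPart (hρ x b) ih using 1
      simp [wordTarget, mul_assoc]
  | cons a w ih =>
    have h : wordTarget x (a :: w) = a.1 * wordTarget x w := rfl
    induction v with
    | nil =>
      rw [mulWord, h, mul_assoc]
      exact consLetter_mem_targetPart (single_mem_letterPart a) (ih [])
    | cons b v ih' =>
      rw [mulWord]
      refine add_mem ?_ ?_
      · rw [h, mul_assoc]
        exact consLetter_mem_targetPart (single_mem_letterPart a) (ih (b :: v))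
      · convert consLetter_mem_targetPart (hρ _ b) ih' using 1
        simp [wordTarget, mul_assoc]

theorem wordMul_mem_targetPart {g h : G} {z z' : PathCoalgebra k (HopfQuiver r)}
    (hz : z ∈ targetPart k r g) (hz' : z' ∈ targetPart k r h) :
    wordMul ρ z z' ∈ targetPart k r (g * h) := by
  induction hz, hz' using Submodule.span_induction₂ with
  | mem_mem z z' hz hz' =>
    obtain ⟨x, w, rfl, rfl⟩ := hz
    obtain ⟨y, v, rfl, rfl⟩ := hz'
    rw [wordMul_ofWord]
    exact mulWord_mem_targetPart ρ hρ x y w v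
  | zero_left => simp
  | zero_right => simp
  | add_left _ _ _ _ _ _ h h' => simpa using add_mem h h'
  | add_right _ _ _ _ _ _ h h' => simpa using add_mem h h'
  | smul_left _ _ _ _ _ h => simpa using Submodule.smul_mem _ _ h
  | smul_right _ _ _ _ _ h => simpa using Submodule.smul_mem _ _ h

/-- The skew Leibniz rule turns both bracketings into three terms, according to the factor that
supplies the last arrow. They agree by induction on the total length; the third also needs that `ρ`
is multiplicative. -/
theorem wordMul_assoc_ofWord (x y s : G) (w v u : List (Letter r)) :
    wordMul ρ (wordMul ρ (ofWord r k x w) (ofWord r k y v)) (ofWord r k s u) =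
      wordMul ρ (ofWord r k x w) (wordMul ρ (ofWord r k y v) (ofWord r k s u)) := by
  induction hn : w.length + v.length + u.length using Nat.strong_induction_on
    generalizing w v u with
  | _ n ih =>
    have hP := ofWord_mem_targetPart (k := k) x w
    have hQ := ofWord_mem_targetPart (k := k) y v
    have hPQ := wordMul_mem_targetPart ρ hρ hP hQ
    refine eq_of_unconsLetter_eq ?_ ?_
    · rw [unconsLetter_wordMul ρ hPQ, unconsLetter_wordMul ρ hP, unconsLetter_wordMul ρ hP,
        unconsLetter_wordMul ρ hQ, map_add, map_add, add_assoc]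
      congr 1
      · cases w with
        | nil => simp
        | cons a w =>
          simp only [unconsLetter_cons, LinearMap.lTensor_tmul, LinearMap.flip_apply]
          rw [ih _ _ w v u rfl]
          rw [← hn]; simp
      congr 1
      · cases v with
        | nil => simp
        | cons b v =>
          simp only [unconsLetter_cons, LinearMap.lTensor_tmul, LinearMap.flip_apply,
            TensorProduct.map_tmul]
          rw [ih _ _ w v u rfl]
          rw [← hn]; simp
      · cases u with
        | nil => simp
        | cons c u =>
          simp only [unconsLetter_cons, TensorProduct.map_tmul]
          rw [ih _ _ w v u rfl, map_mul, Module.End.mul_apply]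
          rw [← hn]; simp
    · simp only [projZero_wordMul]
      cases w <;> cases v <;> cases u <;> simp [mul_assoc]

theorem wordMul_assoc (a b c : PathCoalgebra k (HopfQuiver r)) :
    wordMul ρ (wordMul ρ a b) c = wordMul ρ a (wordMul ρ b c) := by
  induction a using induction_ofWord with
  | zero => simp
  | add _ _ h h' => simp only [map_add, LinearMap.add_apply, h, h']
  | smul _ _ h => simp only [map_smul, LinearMap.smul_apply, h]
  | ofWord x w =>
    induction b using induction_ofWord with
    | zero => simp
    | add _ _ h h' => simp only [map_add, LinearMap.add_apply, h, h']
    | smul _ _ h => simp only [map_smul, LinearMap.smul_apply, h]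
    | ofWord y v =>
      induction c using induction_ofWord with
      | zero => simp
      | add _ _ h h' => simp only [map_add, h, h']
      | smul _ _ h => simp only [map_smul, h]
      | ofWord s u => exact wordMul_assoc_ofWord ρ hρ x y s w v u

end Multiplication

/-! ### Compatibility of the quantum shuffle product with the comultiplication -/

section Compatibility

variable {k : Type u} [Field k] {G : Type v} [Group G] {r : ConjClasses G → ℕ}

/-- The last arrow of a path is the last arrow of the left part of each split whose left part is not
a vertex; removing it leaves the splits of the shorter path. -/
theorem rTensor_unconsLetter_comul (z : PathCoalgebra k (HopfQuiver r)) :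
    TensorProduct.assoc k _ _ _
        ((unconsLetter r k).rTensor _ (CoalgebraStruct.comul (R := k) z)) =
      (CoalgebraStruct.comul (R := k)).lTensor _ (unconsLetter r k z) := by
  induction z using induction_ofWord with
  | zero => simp
  | add _ _ h h' => simp only [map_add, h, h']
  | smul _ _ h => simp only [map_smul, h]
  | ofWord x w =>
    cases w with
    | nil => simp [comul_nil]
    | cons a w =>
      rw [comul_cons]
      simp only [map_add, LinearMap.rTensor_tmul, unconsLetter_nil, TensorProduct.zero_tmul,
        zero_add, unconsLetter_cons, LinearMap.lTensor_tmul]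
      generalize (CoalgebraStruct.comul (R := k) (ofWord r k x w)) = X
      induction X with
      | zero => simp
      | add _ _ h h' => simp only [map_add, h, h', TensorProduct.tmul_add]
      | tmul p q => simp

variable (k r) in
/-- The elements of `kQ ⊗ kQ` whose first legs have target `g`. -/
def targetPart₂ (g : G) :
    Submodule k (PathCoalgebra k (HopfQuiver r) ⊗[k] PathCoalgebra k (HopfQuiver r)) :=
  Submodule.span k {X | ∃ p ∈ targetPart k r g, ∃ q, X = p ⊗ₜ q}

theorem comul_mem_targetPart₂ (x : G) (w : List (Letter r)) :
    CoalgebraStruct.comul (R := k) (ofWord r k x w) ∈ targetPart₂ k r (wordTarget x w) := by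
  induction w with
  | nil =>
    rw [comul_nil]
    exact Submodule.subset_span ⟨_, ofWord_mem_targetPart (r := r) x [], _, rfl⟩
  | cons a w ih =>
    rw [comul_cons]
    refine add_mem (Submodule.subset_span
      ⟨_, ofWord_mem_targetPart (r := r) (wordTarget x (a :: w)) [], _, rfl⟩) ?_
    suffices h : targetPart₂ k r (wordTarget x w) ≤ (targetPart₂ k r (wordTarget x (a :: w))).comap
      ((consLetter r k (Finsupp.single a 1)).rTensor _) from h ih
    rw [targetPart₂, Submodule.span_le]
    rintro _ ⟨p, hp, q, rfl⟩
    exact Submodule.subset_span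
      ⟨_, consLetter_mem_targetPart (single_mem_letterPart a) hp, q, rfl⟩

variable (ρ : Representation k G (Letter r →₀ k))

/-- The skew Leibniz rule for the product of kQ ⊗ kQ, with the last arrow taken from the first leg.
-/
theorem rTensor_unconsLetter_map₂ {g : G}
    {X : PathCoalgebra k (HopfQuiver r) ⊗[k] PathCoalgebra k (HopfQuiver r)}
    (hX : X ∈ targetPart₂ k r g)
    (Y : PathCoalgebra k (HopfQuiver r) ⊗[k] PathCoalgebra k (HopfQuiver r)) :
    TensorProduct.assoc k _ _ _ ((unconsLetter r k).rTensor _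
        (TensorProduct.map₂ (wordMul ρ) (wordMul ρ) X Y)) =
      ((TensorProduct.map₂ (wordMul ρ) (wordMul ρ)).flip Y).lTensor _
          (TensorProduct.assoc k _ _ _ ((unconsLetter r k).rTensor _ X)) +
        TensorProduct.map (ρ g) (TensorProduct.map₂ (wordMul ρ) (wordMul ρ) X)
          (TensorProduct.assoc k _ _ _ ((unconsLetter r k).rTensor _ Y)) := by
  induction hX using Submodule.span_induction with
  | mem X hX =>
    obtain ⟨p, hp, q, rfl⟩ := hX
    induction Y with
    | zero => simp
    | add _ _ h h' =>
      simp only [map_add, LinearMap.lTensor_add, LinearMap.add_apply, h, h']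
      abel
    | tmul p' q' =>
      rw [TensorProduct.map₂_apply_tmul, TensorProduct.map_tmul, LinearMap.rTensor_tmul,
        unconsLetter_wordMul ρ hp, TensorProduct.add_tmul, map_add, LinearMap.rTensor_tmul,
        LinearMap.rTensor_tmul]
      congr 1
      · generalize unconsLetter r k p = U
        induction U with
        | zero => simp
        | add _ _ h h' => simp only [map_add, TensorProduct.add_tmul, h, h']
        | tmul m z => simp
      · generalize unconsLetter r k p' = U
        induction U with
        | zero => simp
        | add _ _ h h' => simp only [map_add, TensorProduct.add_tmul, h, h']
        | tmul m z => simp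
  | zero => simp
  | add _ _ _ _ h h' =>
    simp only [map_add, LinearMap.add_apply, h, h', TensorProduct.map_add_right]
    abel
  | smul b _ _ h =>
    simp only [map_smul, LinearMap.smul_apply, h, TensorProduct.map_smul_right, smul_add]

theorem rTensor_projZero_map₂
    (X Y : PathCoalgebra k (HopfQuiver r) ⊗[k] PathCoalgebra k (HopfQuiver r)) :
    (projZero k (HopfQuiver r)).rTensor _ (TensorProduct.map₂ (wordMul ρ) (wordMul ρ) X Y) =
      TensorProduct.map₂ (wordMul ρ) (wordMul ρ) ((projZero k (HopfQuiver r)).rTensor _ X)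
        ((projZero k (HopfQuiver r)).rTensor _ Y) := by
  induction X with
  | zero => simp
  | add _ _ h h' => simp only [map_add, LinearMap.add_apply, h, h']
  | tmul p q =>
    induction Y with
    | zero => simp
    | add _ _ h h' => simp only [map_add, h, h']
    | tmul p' q' => simp [projZero_wordMul]

variable (hρ : ∀ g a, ρ g (Finsupp.single a 1) ∈ letterPart k r (g * a.1 * g⁻¹))
include hρ

/-- Both sides satisfy the same skew Leibniz rule, which allows induction on the total length. -/
theorem comul_wordMul_ofWord (x y : G) (w v : List (Letter r)) :
    CoalgebraStruct.comul (R := k) (wordMul ρ (ofWord r k x w) (ofWord r k y v)) =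
      TensorProduct.map₂ (wordMul ρ) (wordMul ρ) (CoalgebraStruct.comul (R := k) (ofWord r k x w))
        (CoalgebraStruct.comul (R := k) (ofWord r k y v)) := by
  induction hn : w.length + v.length using Nat.strong_induction_on generalizing w v with
  | _ n ih =>
    have hP := ofWord_mem_targetPart (k := k) x w
    have hQ := ofWord_mem_targetPart (k := k) y v
    refine eq_of_rTensor_unconsLetter_eq ?_ ?_
    · apply (TensorProduct.assoc k _ _ _).injective
      rw [rTensor_unconsLetter_comul, rTensor_unconsLetter_map₂ ρ (comul_mem_targetPart₂ x w),
        rTensor_unconsLetter_comul, rTensor_unconsLetter_comul, unconsLetter_wordMul ρ hP, map_add]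
      congr 1
      · cases w with
        | nil => simp
        | cons a w =>
          simp only [unconsLetter_cons, LinearMap.lTensor_tmul, LinearMap.flip_apply]
          rw [ih _ _ w v rfl]
          rw [← hn]; simp
      · cases v with
        | nil => simp
        | cons b v =>
          simp only [unconsLetter_cons, LinearMap.lTensor_tmul, TensorProduct.map_tmul]
          rw [ih _ _ w v rfl]
          rw [← hn]; simp
    -- Δ followed by the degree-zero projection of the first leg is the left coaction, so this part
    -- says that targets multiply.
    · rw [rTensor_projZero_map₂, ← leftCoaction_eq, ← leftCoaction_eq, ← leftCoaction_eq,
        leftCoaction_of_mem hP, leftCoaction_of_mem hQ,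
        leftCoaction_of_mem (wordMul_mem_targetPart ρ hρ hP hQ)]
      simp

theorem comul_wordMul (a b : PathCoalgebra k (HopfQuiver r)) :
    CoalgebraStruct.comul (R := k) (wordMul ρ a b) =
      TensorProduct.map₂ (wordMul ρ) (wordMul ρ) (CoalgebraStruct.comul (R := k) a)
        (CoalgebraStruct.comul (R := k) b) := by
  induction a using induction_ofWord with
  | zero => simp
  | add _ _ h h' => simp only [map_add, LinearMap.add_apply, h, h']
  | smul _ _ h => simp only [map_smul, LinearMap.smul_apply, h]
  | ofWord x w =>
    induction b using induction_ofWord with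
    | zero => simp
    | add _ _ h h' => simp only [map_add, h, h']
    | smul _ _ h => simp only [map_smul, h]
    | ofWord y v => exact comul_wordMul_ofWord ρ hρ x y w v

end Compatibility

end

end HopfQuivers

namespace HopfQuivers

noncomputable section

/-! ### The antipode -/

/-! ### Geometric series in the convolution algebra -/

section Convolution

open WithConv

variable {k : Type u} [Field k] {G : Type v} [Group G] {r : ConjClasses G → ℕ}

variable (k r) in
/-- The part of degree `n` of `kQ ⊗ kQ`. -/
def degreePart₂ (n : ℕ) :
    Submodule k (PathCoalgebra k (HopfQuiver r) ⊗[k] PathCoalgebra k (HopfQuiver r)) :=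
  Submodule.span k {X | ∃ y v z u, v.length + u.length = n ∧
    X = ofWord r k y v ⊗ₜ ofWord r k z u}

theorem comul_mem_degreePart₂ (x : G) (w : List (Letter r)) :
    CoalgebraStruct.comul (R := k) (ofWord r k x w) ∈ degreePart₂ k r w.length := by
  induction w with
  | nil =>
    rw [comul_nil]
    exact Submodule.subset_span ⟨_, [], _, [], rfl, rfl⟩
  | cons a w ih =>
    rw [comul_cons]
    refine add_mem (Submodule.subset_span ⟨_, [], _, a :: w, Nat.zero_add _, rfl⟩) ?_
    suffices h : degreePart₂ k r w.length ≤ (degreePart₂ k r (a :: w).length).comap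
      ((consLetter r k (Finsupp.single a 1)).rTensor _) from h ih
    rw [degreePart₂, Submodule.span_le]
    rintro _ ⟨y, v, z, u, h, rfl⟩
    refine Submodule.subset_span ⟨y, a :: v, z, u, ?_, ?_⟩
    · simp only [List.length_cons, ← h]; omega
    · simp

variable {A : Type*} [Ring A] [Algebra k A]

/-- Since Δ preserves the total degree, the value on a word depends only on pairs of that total
length; this allows an infinite series to be exchanged for a truncation. -/
theorem convMul_ofWord_congr {φ ψ φ' ψ' : WithConv (PathCoalgebra k (HopfQuiver r) →ₗ[k] A)}
    (x : G) (w : List (Letter r))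
    (h : ∀ y v z u, v.length + u.length = w.length →
      φ.ofConv (ofWord r k y v) * ψ.ofConv (ofWord r k z u) =
        φ'.ofConv (ofWord r k y v) * ψ'.ofConv (ofWord r k z u)) :
    (φ * ψ).ofConv (ofWord r k x w) = (φ' * ψ').ofConv (ofWord r k x w) := by
  have : degreePart₂ k r w.length ≤ LinearMap.eqLocus
      (LinearMap.mul' k A ∘ₗ TensorProduct.map φ.ofConv ψ.ofConv)
      (LinearMap.mul' k A ∘ₗ TensorProduct.map φ'.ofConv ψ'.ofConv) := by
    refine Submodule.span_le.2 ?_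
    rintro _ ⟨y, v, z, u, hl, rfl⟩
    simpa using h y v z u hl
  exact this (comul_mem_degreePart₂ x w)

/-- The n-th convolution power cuts a path into n pieces, and with fewer than n arrows one of the
pieces is a vertex. -/
theorem convPow_ofWord {φ : WithConv (PathCoalgebra k (HopfQuiver r) →ₗ[k] A)}
    (hφ : ∀ x, φ.ofConv (ofWord r k x []) = 0) {n : ℕ} (x : G) {w : List (Letter r)}
    (hn : w.length < n) : (φ ^ n).ofConv (ofWord r k x w) = 0 := by
  induction n generalizing x w with
  | zero => omega
  | succ n ih =>
    rw [pow_succ']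
    rw [convMul_ofWord_congr (φ' := 0) (ψ' := 0) x w]
    · simp
    · intro y v z u h
      cases v with
      | nil => simp [hφ]
      | cons b v =>
        rw [ih z (by simp at h; omega)]
        simp

/-- The convolution inverse of `1 - φ`, if `φ` vanishes on the vertices. -/
def convGeom (φ : WithConv (PathCoalgebra k (HopfQuiver r) →ₗ[k] A)) :
    WithConv (PathCoalgebra k (HopfQuiver r) →ₗ[k] A) :=
  toConv (wordLift k fun x w =>
    -- The powers beyond the length of the word vanish on it once `φ` kills the vertices, so this
    -- truncation is the whole series.
    (∑ i ∈ Finset.range (w.length + 1), φ ^ i).ofConv (ofWord r k x w))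

theorem ofConv_sum {ι : Type*} (s : Finset ι)
    (φ : ι → WithConv (PathCoalgebra k (HopfQuiver r) →ₗ[k] A)) :
    (∑ i ∈ s, φ i).ofConv = ∑ i ∈ s, (φ i).ofConv := by
  classical
  induction s using Finset.induction_on with
  | empty => simp
  | insert i s hi ih => rw [Finset.sum_insert hi, Finset.sum_insert hi, ofConv_add, ih]

theorem convGeom_ofWord {φ : WithConv (PathCoalgebra k (HopfQuiver r) →ₗ[k] A)}
    (hφ : ∀ x, φ.ofConv (ofWord r k x []) = 0) {n : ℕ} (x : G) {w : List (Letter r)}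
    (hn : w.length ≤ n) : (convGeom φ).ofConv (ofWord r k x w) =
      (∑ i ∈ Finset.range (n + 1), φ ^ i).ofConv (ofWord r k x w) := by
  rw [convGeom, ofConv_toConv, wordLift_ofWord]
  simp only [ofConv_sum, LinearMap.sum_apply]
  refine Finset.sum_subset (fun i hi => ?_) fun i _ hi => ?_
  · simp only [Finset.mem_range] at hi ⊢; omega
  · exact convPow_ofWord hφ x (by simpa using hi)

/-- On a word of length n, truncate the series at n for all splits at once. The sum telescopes to 1
- φ^(n+1), and this power vanishes on the word. -/
theorem convGeom_mul {φ : WithConv (PathCoalgebra k (HopfQuiver r) →ₗ[k] A)}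
    (hφ : ∀ x, φ.ofConv (ofWord r k x []) = 0) : convGeom φ * (1 - φ) = 1 := by
  apply ofConv_injective
  refine hom_ext_ofWord fun x w => ?_
  rw [convMul_ofWord_congr (φ' := ∑ i ∈ Finset.range (w.length + 1), φ ^ i) (ψ' := 1 - φ) x w,
    geom_sum_mul_neg]
  · simp [convPow_ofWord hφ x (Nat.lt_succ_self w.length)]
  · intro y v z u h
    rw [convGeom_ofWord hφ y (by omega : v.length ≤ w.length)]

theorem mul_convGeom {φ : WithConv (PathCoalgebra k (HopfQuiver r) →ₗ[k] A)}
    (hφ : ∀ x, φ.ofConv (ofWord r k x []) = 0) : (1 - φ) * convGeom φ = 1 := by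
  apply ofConv_injective
  refine hom_ext_ofWord fun x w => ?_
  rw [convMul_ofWord_congr (ψ' := ∑ i ∈ Finset.range (w.length + 1), φ ^ i) (φ' := 1 - φ) x w,
    mul_neg_geom_sum]
  · simp [convPow_ofWord hφ x (Nat.lt_succ_self w.length)]
  · intro y v z u h
    rw [convGeom_ofWord hφ z (by omega : u.length ≤ w.length)]

end Convolution

/-! ### The convolution inverse of the identity, and its degree -/

section Antipode

open WithConv

variable {k : Type u} [Field k] {G : Type v} [Group G] {r : ConjClasses G → ℕ}
  (ρ : Representation k G (Letter r →₀ k))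
  (hρ : ∀ g a, ρ g (Finsupp.single a 1) ∈ letterPart k r (g * a.1 * g⁻¹))

/-- The path coalgebra, with the multiplication `wordMul ρ`. -/
@[nolint unusedArguments]
def WordAlgebra (_ρ : Representation k G (Letter r →₀ k))
    (_hρ : ∀ g a, _ρ g (Finsupp.single a 1) ∈ letterPart k r (g * a.1 * g⁻¹)) : Type (max u v) :=
  PathCoalgebra k (HopfQuiver r)

instance : AddCommGroup (WordAlgebra ρ hρ) :=
  inferInstanceAs (AddCommGroup (PathCoalgebra k (HopfQuiver r)))

instance : Module k (WordAlgebra ρ hρ) :=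
  inferInstanceAs (Module k (PathCoalgebra k (HopfQuiver r)))

instance : Ring (WordAlgebra ρ hρ) where
  __ := (inferInstance : AddCommGroup (WordAlgebra ρ hρ))
  mul a b := wordMul ρ a b
  one := ofWord r k 1 []
  mul_assoc := wordMul_assoc ρ hρ
  one_mul := one_wordMul ρ
  mul_one := wordMul_one ρ
  left_distrib a b c := map_add (wordMul ρ a) b c
  right_distrib a b c := LinearMap.map_add₂ (wordMul ρ) a b c
  zero_mul a := LinearMap.map_zero₂ (wordMul ρ) a
  mul_zero a := map_zero (wordMul ρ a)

instance : Algebra k (WordAlgebra ρ hρ) :=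
  Algebra.ofModule (fun c a b => LinearMap.map_smul₂ (wordMul ρ) c a b)
    (fun c a b => map_smul (wordMul ρ a) c b)

/-- The path coalgebra, as a module, is the algebra. -/
def toWordAlgebra : PathCoalgebra k (HopfQuiver r) →ₗ[k] WordAlgebra ρ hρ := LinearMap.id

theorem toWordAlgebra_mul (a b : PathCoalgebra k (HopfQuiver r)) :
    toWordAlgebra ρ hρ (wordMul ρ a b) = toWordAlgebra ρ hρ a * toWordAlgebra ρ hρ b := rfl

theorem toWordAlgebra_one : toWordAlgebra ρ hρ (ofWord r k 1 []) = 1 := rfl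

/-- The projection onto the group algebra, followed by its antipode. -/
def vertexInv : PathCoalgebra k (HopfQuiver r) →ₗ[k] PathCoalgebra k (HopfQuiver r) :=
  wordLift k fun x w => match w with
    | [] => ofWord r k x⁻¹ []
    | _ :: _ => 0

@[simp]
theorem vertexInv_nil (x : G) : vertexInv (ofWord r k x []) = ofWord r k x⁻¹ [] := by
  simp [vertexInv]

@[simp]
theorem vertexInv_cons (x : G) (a : Letter r) (w : List (Letter r)) :
    vertexInv (ofWord r k x (a :: w)) = 0 := by
  simp [vertexInv]

theorem vertexInv_comp_consLetter (m : Letter r →₀ k) :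
    vertexInv ∘ₗ consLetter r k m = 0 := by
  have : (consLetter r k).compr₂ vertexInv = 0 := by
    refine Finsupp.lhom_ext' fun a => LinearMap.ext_ring ?_
    refine hom_ext_ofWord fun x w => ?_
    simp
  exact LinearMap.ext fun z => LinearMap.congr_fun₂ this m z

/-- The linear maps from the path coalgebra to the algebra, with the convolution product. -/
abbrev WordConv : Type (max u v) :=
  WithConv (PathCoalgebra k (HopfQuiver r) →ₗ[k] WordAlgebra ρ hρ)

theorem convMul_nil (φ ψ : WordConv ρ hρ) (x : G) : (φ * ψ).ofConv (ofWord r k x []) =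
    φ.ofConv (ofWord r k x []) * ψ.ofConv (ofWord r k x []) := by
  simp [LinearMap.convMul_def, comul_nil]

theorem convMul_cons (φ ψ : WordConv ρ hρ) (x : G) (a : Letter r) (w : List (Letter r)) :
    (φ * ψ).ofConv (ofWord r k x (a :: w)) =
    φ.ofConv (ofWord r k (wordTarget x (a :: w)) []) * ψ.ofConv (ofWord r k x (a :: w)) +
      LinearMap.mul' k _ (TensorProduct.map (φ.ofConv ∘ₗ consLetter r k (Finsupp.single a 1))
        ψ.ofConv (CoalgebraStruct.comul (R := k) (ofWord r k x w))) := by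
  simp only [LinearMap.convMul_def, ofConv_toConv, LinearMap.comp_apply, comul_cons, map_add,
    TensorProduct.map_tmul, LinearMap.mul'_apply]
  rw [← LinearMap.comp_apply (TensorProduct.map _ _), LinearMap.map_comp_rTensor]

/-- Only splits with a vertex on the left survive the projection, and `vertexInv` then kills every
path of positive length. This supplies the inverse needed to pass from left to right invertibility
of the identity. -/
theorem projZero_mul_vertexInv :
    (toConv (toWordAlgebra ρ hρ ∘ₗ projZero k (HopfQuiver r)) : WordConv ρ hρ) *
      toConv (toWordAlgebra ρ hρ ∘ₗ vertexInv) = 1 := by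
  apply ofConv_injective
  refine hom_ext_ofWord fun x w => ?_
  cases w with
  | nil =>
    rw [convMul_nil]
    simp [← toWordAlgebra_mul, toWordAlgebra_one, LinearMap.convOne_def, counit_nil]
  | cons a w =>
    have : projZero k (HopfQuiver r) ∘ₗ consLetter r k (Finsupp.single a 1) = 0 :=
      LinearMap.ext fun z => projZero_consLetter _ z
    rw [convMul_cons]
    simp [LinearMap.comp_assoc, this, LinearMap.convOne_def, counit_cons]

/-- The difference between the unit and the convolution product of `vertexInv` with the identity;
it vanishes on the vertices. -/
def antipodeDefect : WordConv ρ hρ :=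
  1 - toConv (toWordAlgebra ρ hρ ∘ₗ vertexInv) * toConv (toWordAlgebra ρ hρ)

theorem antipodeDefect_nil (x : G) : (antipodeDefect ρ hρ).ofConv (ofWord r k x []) = 0 := by
  rw [antipodeDefect, ofConv_sub, LinearMap.sub_apply, convMul_nil]
  simp [← toWordAlgebra_mul, toWordAlgebra_one, LinearMap.convOne_def, counit_nil]

/-- The antipode, as the convolution inverse of the identity. -/
def convAntipode : WordConv ρ hρ :=
  convGeom (antipodeDefect ρ hρ) * toConv (toWordAlgebra ρ hρ ∘ₗ vertexInv)

theorem convAntipode_mul : convAntipode ρ hρ * toConv (toWordAlgebra ρ hρ) = 1 := by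
  have := convGeom_mul (antipodeDefect_nil ρ hρ)
  rwa [antipodeDefect, sub_sub_cancel, ← mul_assoc] at this

theorem mul_convAntipode : toConv (toWordAlgebra ρ hρ) * convAntipode ρ hρ = 1 := by
  have := mul_convGeom (antipodeDefect_nil ρ hρ)
  rw [antipodeDefect, sub_sub_cancel, ← antipodeDefect] at this
  -- With p the projection to degree zero, v = `vertexInv` and q the geometric series: id * (q * v)
  -- = (p * v) * id * q * v = p * (v * id * q) * v = p * v = 1.
  calc _ = (toConv (toWordAlgebra ρ hρ ∘ₗ projZero k (HopfQuiver r)) *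
        toConv (toWordAlgebra ρ hρ ∘ₗ vertexInv)) * toConv (toWordAlgebra ρ hρ) *
          convAntipode ρ hρ := by
        rw [projZero_mul_vertexInv, one_mul]
    _ = toConv (toWordAlgebra ρ hρ ∘ₗ projZero k (HopfQuiver r)) *
        (toConv (toWordAlgebra ρ hρ ∘ₗ vertexInv) * toConv (toWordAlgebra ρ hρ) *
          convGeom (antipodeDefect ρ hρ)) * toConv (toWordAlgebra ρ hρ ∘ₗ vertexInv) := by
        simp only [convAntipode, mul_assoc]
    _ = 1 := by rw [this, mul_one, projZero_mul_vertexInv]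

/-- A linear map that preserves the degree. -/
def IsGradedConv (φ : WordConv ρ hρ) : Prop :=
  ∀ x w, (show PathCoalgebra k (HopfQuiver r) from φ.ofConv (ofWord r k x w)) ∈
    degreePart k (HopfQuiver r) w.length

variable {ρ hρ}

theorem IsGradedConv.sub {φ ψ : WordConv ρ hρ} (hφ : IsGradedConv ρ hρ φ)
    (hψ : IsGradedConv ρ hρ ψ) : IsGradedConv ρ hρ (φ - ψ) :=
  fun x w => sub_mem (hφ x w) (hψ x w)

theorem IsGradedConv.sum {ι : Type*} (s : Finset ι) {φ : ι → WordConv ρ hρ}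
    (hφ : ∀ i, IsGradedConv ρ hρ (φ i)) : IsGradedConv ρ hρ (∑ i ∈ s, φ i) := by
  intro x w
  rw [ofConv_sum, LinearMap.sum_apply]
  exact sum_mem fun i _ => hφ i x w

theorem IsGradedConv.mul {φ ψ : WordConv ρ hρ} (hφ : IsGradedConv ρ hρ φ)
    (hψ : IsGradedConv ρ hρ ψ) : IsGradedConv ρ hρ (φ * ψ) := by
  intro x w
  have := comul_mem_degreePart₂ (k := k) x w
  refine (Submodule.span_le (p := Submodule.comap (LinearMap.mul' k _ ∘ₗ
    TensorProduct.map φ.ofConv ψ.ofConv) (degreePart k (HopfQuiver r) w.length))).2 ?_ this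
  rintro _ ⟨y, v, z, u, h, rfl⟩
  rw [← h]
  exact wordMul_mem ρ (hφ y v) (hψ z u)

theorem IsGradedConv.one : IsGradedConv ρ hρ 1 := by
  intro x w
  cases w with
  | nil =>
    have : (1 : WordConv ρ hρ).ofConv (ofWord r k x []) = 1 := by
      simp [LinearMap.convOne_def, counit_nil]
    rw [this]
    exact ofWord_mem (r := r) (1 : G) []
  | cons a w =>
    have : (1 : WordConv ρ hρ).ofConv (ofWord r k x (a :: w)) = 0 := by
      simp [LinearMap.convOne_def, counit_cons]
    rw [this]
    exact zero_mem _

theorem IsGradedConv.pow {φ : WordConv ρ hρ} (hφ : IsGradedConv ρ hρ φ) (n : ℕ) :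
    IsGradedConv ρ hρ (φ ^ n) := by
  induction n with
  | zero => rw [pow_zero]; exact .one
  | succ n ih => rw [pow_succ]; exact ih.mul hφ

theorem IsGradedConv.geom {φ : WordConv ρ hρ} (hφ : IsGradedConv ρ hρ φ) :
    IsGradedConv ρ hρ (convGeom φ) := by
  intro x w
  rw [convGeom, ofConv_toConv, wordLift_ofWord]
  exact IsGradedConv.sum _ (fun i => hφ.pow i) x w

theorem isGradedConv_convAntipode : IsGradedConv ρ hρ (convAntipode ρ hρ) := by
  have h1 : IsGradedConv ρ hρ (toConv (toWordAlgebra ρ hρ ∘ₗ vertexInv)) := by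
    intro x w
    cases w with
    | nil =>
      rw [ofConv_toConv, LinearMap.comp_apply, vertexInv_nil]
      exact ofWord_mem (r := r) x⁻¹ []
    | cons a w =>
      rw [ofConv_toConv, LinearMap.comp_apply, vertexInv_cons, map_zero]
      exact zero_mem _
  have h2 : IsGradedConv ρ hρ (toConv (toWordAlgebra ρ hρ)) := fun x w => ofWord_mem x w
  exact (IsGradedConv.one.sub (h1.mul h2)).geom.mul h1

variable (ρ hρ)

/-- The graded Hopf algebra structure given by a Yetter-Drinfeld structure on the letters. -/
def wordHopfStructure : GradedHopfStructureOver k r where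
  mul := wordMul ρ
  one := ofWord r k 1 []
  antipode := (convAntipode ρ hρ).ofConv
  mul_assoc := wordMul_assoc ρ hρ
  one_mul := one_wordMul ρ
  mul_one := wordMul_one ρ
  counit_one := counit_nil 1
  counit_mul := counit_wordMul ρ
  comul_one := comul_nil 1
  comul_mul := comul_wordMul ρ hρ
  mul_antipode_rTensor_comul a := by
    have := LinearMap.congr_fun (congrArg ofConv (convAntipode_mul ρ hρ)) a
    exact this.trans (Algebra.algebraMap_eq_smul_one (R := k) (A := WordAlgebra ρ hρ)
      (CoalgebraStruct.counit (R := k) a))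
  mul_antipode_lTensor_comul a := by
    have := LinearMap.congr_fun (congrArg ofConv (mul_convAntipode ρ hρ)) a
    exact this.trans (Algebra.algebraMap_eq_smul_one (R := k) (A := WordAlgebra ρ hρ)
      (CoalgebraStruct.counit (R := k) a))
  one_mem := ofWord_mem (r := r) 1 []
  mul_mem _ _ _ _ := wordMul_mem ρ
  antipode_mem n a ha := by
    rw [degreePart_eq] at ha
    refine (Submodule.span_le (p := Submodule.comap (convAntipode ρ hρ).ofConv
      (degreePart k (HopfQuiver r) n))).2 ?_ ha
    rintro _ ⟨x, w, rfl, rfl⟩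
    exact isGradedConv_convAntipode x w
  one_eq_vertex := ofWord_nil k 1
  mul_vertex x y := by
    have := wordMul_nil_nil (k := k) ρ x y
    rwa [ofWord_nil, ofWord_nil, ofWord_nil] at this

end Antipode

end

end HopfQuivers

namespace HopfQuivers

noncomputable section

/-! ### The structure given by a collection of modules -/

section Components

variable {k : Type u} [Field k] {G : Type v} [Group G] {r : ConjClasses G → ℕ}

/-- The letters of a given degree. -/
def classLetter {C : ConjClasses G} {c : G} (h : ConjClasses.mk c = C) (j : Fin (r C)) :
    Letter r := ⟨c, Fin.cast (congrArg r h.symm) j⟩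

theorem classLetter_injective {C : ConjClasses G} {c : G} (h : ConjClasses.mk c = C) :
    Function.Injective (classLetter (r := r) h) := by
  intro i j hij
  subst h
  exact eq_of_heq (Sigma.mk.inj hij).2

variable (k r) in
/-- The basis of the isotypic component `ᵘ(kQ₁)¹` given by the arrows from `1` to `u`. -/
def componentBasis {C : ConjClasses G} {u : G} (h : ConjClasses.mk u = C) :
    Module.Basis (Fin (r C)) k (isotypic k (toVertex r u) (toVertex r 1)) :=
  have hli : LinearIndependent k fun j : Fin (r C) => ofWord r k 1 [classLetter h j] :=
    (wordBasis r k).linearIndependent.comp (fun j => ((1 : G), [classLetter h j])) <| by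
      intro i j hij
      simp only [Prod.mk.injEq, List.cons.injEq, true_and, and_true] at hij
      exact classLetter_injective h hij
  (Module.Basis.span hli).map (LinearEquiv.ofEq _ _ (by
    rw [isotypic_eq]
    congr 1
    ext z
    constructor
    · rintro ⟨j, rfl⟩
      exact ⟨classLetter h j, mul_one _, rfl⟩
    · rintro ⟨a, ha, rfl⟩
      subst h
      rw [mul_one] at ha
      subst ha
      exact ⟨a.2, rfl⟩))

theorem componentBasis_apply {C : ConjClasses G} {u : G} (h : ConjClasses.mk u = C)
    (j : Fin (r C)) : (componentBasis k r h j : PathCoalgebra k (HopfQuiver r)) =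
      ofWord r k 1 [classLetter h j] := by
  rw [componentBasis, Module.Basis.map_apply, LinearEquiv.coe_ofEq_apply]
  exact congrArg Subtype.val (Module.Basis.mk_apply _ _ j) |>.trans (by simp)

end Components

/-! ### Linearity over the opposite group algebra, checked on group elements -/

section OppositeModules

variable {k : Type u} [Field k] {Z : Type*} [Group Z] {M M' : Type*} [AddCommGroup M]
  [AddCommGroup M'] [Module k M] [Module k M'] [Module (MonoidAlgebra k Z)ᵐᵒᵖ M]
  [Module (MonoidAlgebra k Z)ᵐᵒᵖ M'] [IsScalarTower k (MonoidAlgebra k Z)ᵐᵒᵖ M]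
  [IsScalarTower k (MonoidAlgebra k Z)ᵐᵒᵖ M']

/-- A linear equivalence that commutes with the right action of a group is linear over the
opposite of the group algebra. -/
def oppositeLinearEquiv (e : M ≃ₗ[k] M')
    (h : ∀ (z : Z) (m : M), e (MulOpposite.op (MonoidAlgebra.single z (1 : k)) • m) =
      MulOpposite.op (MonoidAlgebra.single z (1 : k)) • e m) :
    M ≃ₗ[(MonoidAlgebra k Z)ᵐᵒᵖ] M' :=
  { e with
    map_smul' := by
      intro a m
      induction a using MulOpposite.rec' with
      | _ a =>
      change e (MulOpposite.op a • m) = MulOpposite.op a • e m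
      induction a using MonoidAlgebra.induction_linear with
      | zero => simp
      | add a b ha hb => rw [MulOpposite.op_add, add_smul, add_smul, map_add, ha, hb]
      | single z c =>
        have : MonoidAlgebra.single z c = c • MonoidAlgebra.single z (1 : k) := by simp
        rw [this, MulOpposite.op_smul, smul_assoc, smul_assoc, map_smul, h] }

end OppositeModules

/-! ### The induced Yetter-Drinfeld module and its isotypic components -/

section Induced

variable {k : Type u} [Field k] {G : Type v} [Group G] {r : ConjClasses G → ℕ}
  {rep : ConjClasses G → G}

namespace ModuleCollection

variable (N : ModuleCollection.{u, v, w} k rep r)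

/-- A basis of the module `M_C`. -/
def basis (C : ConjClasses G) : Module.Basis (Fin (r C)) k (N.M C) :=
  haveI := Module.finite_of_rank_eq_nat (N.rank_eq C)
  Module.finBasisOfFinrankEq k (N.M C) (Module.finrank_eq_of_rank_eq (N.rank_eq C))

open Classical in
/-- The left action `m ↦ m · z⁻¹` of the elements `z` of the centralizer on `M_C`. -/
def leftAct (C : ConjClasses G) (z : G) : Module.End k (N.M C) :=
  if h : z ∈ Subgroup.centralizer {rep C} then
    Algebra.lsmul k k (N.M C) (MulOpposite.op (MonoidAlgebra.single
      (⟨z, h⟩ : Subgroup.centralizer {rep C})⁻¹ (1 : k)))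
  else 0

theorem leftAct_apply {C : ConjClasses G} (z : Subgroup.centralizer {rep C}) (m : N.M C) :
    N.leftAct C z m = MulOpposite.op (MonoidAlgebra.single z⁻¹ (1 : k)) • m := by
  simp [leftAct]

theorem leftAct_one (C : ConjClasses G) (m : N.M C) : N.leftAct C 1 m = m := by
  have := N.leftAct_apply (C := C) 1 m
  rw [OneMemClass.coe_one, inv_one, ← MonoidAlgebra.one_def, MulOpposite.op_one, one_smul] at this
  exact this

theorem leftAct_mul {C : ConjClasses G} {z z' : G} (hz : z ∈ Subgroup.centralizer {rep C})
    (hz' : z' ∈ Subgroup.centralizer {rep C}) (m : N.M C) :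
    N.leftAct C (z * z') m = N.leftAct C z (N.leftAct C z' m) := by
  have h1 := N.leftAct_apply ⟨z, hz⟩ (N.leftAct C z' m)
  have h2 := N.leftAct_apply ⟨z', hz'⟩ m
  have h3 := N.leftAct_apply (⟨z, hz⟩ * ⟨z', hz'⟩) m
  have h4 : N.leftAct C (z * z') m = _ := h3
  rw [h4, h1, h2, smul_smul, ← MulOpposite.op_mul, MonoidAlgebra.single_mul_single, mul_inv_rev,
    mul_one]

/-- The embedding of `M_C` as the combinations of letters of degree `c`, for `c` in `C`. -/
def embed {C : ConjClasses G} {c : G} (h : ConjClasses.mk c = C) :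
    N.M C →ₗ[k] (Letter r →₀ k) :=
  (N.basis C).constr k fun j => Finsupp.single (classLetter h j) 1

theorem embed_basis {C : ConjClasses G} {c : G} (h : ConjClasses.mk c = C) (j : Fin (r C)) :
    N.embed h (N.basis C j) = Finsupp.single (classLetter h j) 1 :=
  (N.basis C).constr_basis k _ _

theorem embed_mem {C : ConjClasses G} {c : G} (h : ConjClasses.mk c = C) (m : N.M C) :
    N.embed h m ∈ letterPart k r c := by
  have : LinearMap.range (N.embed h) ≤ letterPart k r c := by
    rw [embed, Module.Basis.constr_range, Submodule.span_le]
    rintro _ ⟨j, rfl⟩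
    exact single_mem_letterPart (k := k) (classLetter h j)
  exact this ⟨m, rfl⟩

/-- The degree and its class proof have to change together, while the module `N.M C` stays fixed. -/
theorem embed_congr {C : ConjClasses G} {c c' : G} (h : ConjClasses.mk c = C)
    (h' : ConjClasses.mk c' = C) (hc : c = c') {m m' : N.M C} (hm : m = m') :
    N.embed h m = N.embed h' m' := by
  subst hc hm
  rfl

end ModuleCollection

open Classical in
variable (rep) in
/-- An element that conjugates the chosen element of the class of `c` to `c`. -/
def conjugator (c : G) : G :=
  -- Taking 1 at the representative makes the centralizer act on the copy of `M_C` there by the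
  -- given action itself, not by a conjugate of it.
  if c = rep (ConjClasses.mk c) then 1
  else if h : IsConj (rep (ConjClasses.mk c)) c then (isConj_iff.1 h).choose else 1

variable (hrep : ∀ C, ConjClasses.mk (rep C) = C)

include hrep

theorem conjugator_rep (C : ConjClasses G) : conjugator rep (rep C) = 1 := by
  rw [conjugator, if_pos (by rw [hrep])]

theorem conjugator_spec (c : G) :
    conjugator rep c * rep (ConjClasses.mk c) * (conjugator rep c)⁻¹ = c := by
  have h : IsConj (rep (ConjClasses.mk c)) c :=
    ConjClasses.mk_eq_mk_iff_isConj.1 (hrep _)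
  rw [conjugator, dif_pos h]
  split_ifs with h'
  · simpa using h'.symm
  · exact (isConj_iff.1 h).choose_spec

omit hrep in
theorem mk_conj {C : ConjClasses G} {c : G} (h : ConjClasses.mk c = C) (g : G) :
    ConjClasses.mk (g * c * g⁻¹) = C := by
  rw [← h, ConjClasses.mk_eq_mk_iff_isConj]
  exact (isConj_iff.2 ⟨g, rfl⟩).symm

/-- The three factors, from right to left, conjugate the representative to c, then to c', then back.
This is the cocycle of the induced representation. -/
theorem conjugator_mem {C : ConjClasses G} {c c' : G} (h : ConjClasses.mk c = C) {g : G}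
    (hc : g * c * g⁻¹ = c') :
    (conjugator rep c')⁻¹ * g * conjugator rep c ∈ Subgroup.centralizer {rep C} := by
  have h1 := conjugator_spec hrep c
  have h2 := conjugator_spec hrep c'
  rw [← hc, mk_conj h g, hc] at h2
  rw [h] at h1
  rw [Subgroup.mem_centralizer_singleton_iff]
  generalize conjugator rep c = t at *
  generalize conjugator rep c' = t' at *
  have h3 : t' * rep C * t'⁻¹ = g * (t * rep C * t⁻¹) * g⁻¹ := by rw [h1, h2, hc]
  have h4 : rep C * t'⁻¹ = t'⁻¹ * (g * (t * rep C * t⁻¹) * g⁻¹) := by rw [← h3]; group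
  calc _ = t'⁻¹ * (g * (t * rep C * t⁻¹) * g⁻¹) * g * t := by group
    _ = _ := by rw [← h4]; group

namespace ModuleCollection

variable (N : ModuleCollection.{u, v, w} k rep r)

omit hrep in
/-- The action of an element of the group on the combinations of letters, by conjugation. -/
def letterAct (g : G) : Module.End k (Letter r →₀ k) :=
  Finsupp.lift _ k _ fun a => N.embed (mk_conj rfl g)
    (N.leftAct (ConjClasses.mk a.1)
      ((conjugator rep (g * a.1 * g⁻¹))⁻¹ * g * conjugator rep a.1) (N.basis _ a.2))

omit hrep in
theorem letterAct_single (g : G) (a : Letter r) : N.letterAct g (Finsupp.single a 1) =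
    N.embed (mk_conj rfl g) (N.leftAct (ConjClasses.mk a.1)
      ((conjugator rep (g * a.1 * g⁻¹))⁻¹ * g * conjugator rep a.1) (N.basis _ a.2)) := by
  simp [letterAct]

omit hrep in
theorem letterAct_embed (g : G) {C : ConjClasses G} {c : G} (h : ConjClasses.mk c = C)
    (m : N.M C) : N.letterAct g (N.embed h m) = N.embed (mk_conj h g)
      (N.leftAct C ((conjugator rep (g * c * g⁻¹))⁻¹ * g * conjugator rep c) m) := by
  subst h
  suffices H : N.letterAct g ∘ₗ N.embed rfl = N.embed (mk_conj rfl g) ∘ₗ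
      N.leftAct _ ((conjugator rep (g * c * g⁻¹))⁻¹ * g * conjugator rep c) from
    LinearMap.congr_fun H m
  refine (N.basis _).ext fun j => ?_
  rw [LinearMap.comp_apply, embed_basis, letterAct_single]
  rfl

omit hrep in
theorem single_eq_embed (a : Letter r) :
    Finsupp.single a (1 : k) = N.embed (rfl : ConjClasses.mk a.1 = _) (N.basis _ a.2) :=
  (N.embed_basis rfl a.2).symm

/-- The action of the group on the combinations of letters. -/
def letterRep : Representation k G (Letter r →₀ k) where
  toFun := N.letterAct
  map_one' := by
    refine Finsupp.lhom_ext' fun a => LinearMap.ext_ring ?_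
    simp only [LinearMap.comp_apply, Finsupp.lsingle_apply, Module.End.one_apply]
    rw [N.single_eq_embed, letterAct_embed]
    refine N.embed_congr _ _ (by simp) ?_
    simp [leftAct_one]
  map_mul' g g' := by
    refine Finsupp.lhom_ext' fun a => LinearMap.ext_ring ?_
    simp only [LinearMap.comp_apply, Finsupp.lsingle_apply, Module.End.mul_apply]
    rw [N.single_eq_embed, letterAct_embed, letterAct_embed, letterAct_embed]
    have hc : g * g' * a.1 * (g * g')⁻¹ = g * (g' * a.1 * g'⁻¹) * g⁻¹ := by group
    refine N.embed_congr _ _ hc ?_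
    -- In the product of the two cocycle values the conjugator of g' a g'⁻¹ cancels.
    rw [← leftAct_mul]
    · congr 1
      congr 1
      rw [hc]
      group
    · exact conjugator_mem hrep (mk_conj rfl g') rfl
    · exact conjugator_mem hrep rfl rfl

theorem letterRep_mem (g : G) (a : Letter r) :
    N.letterRep hrep g (Finsupp.single a 1) ∈ letterPart k r (g * a.1 * g⁻¹) := by
  change N.letterAct g _ ∈ _
  rw [letterAct_single]
  exact N.embed_mem _ _

/-- The graded Hopf algebra structure given by a collection of modules. -/
def hopfStructure : GradedHopfStructureOver k r :=
  wordHopfStructure (N.letterRep hrep) (N.letterRep_mem hrep)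

end ModuleCollection

omit hrep in
-- With `wordMul_consLetter_nil`, this identifies kQ₁ as the Hopf bimodule V ⊗ kG: G acts diagonally
-- from the left, and only on the source from the right. Conjugation m ↦ z⁻¹ m z at source 1 is
-- therefore the action of z⁻¹ on V.
theorem wordMul_nil_consLetter (ρ : Representation k G (Letter r →₀ k)) (x y : G)
    (m : Letter r →₀ k) : wordMul ρ (ofWord r k x []) (consLetter r k m (ofWord r k y [])) =
      consLetter r k (ρ x m) (ofWord r k (x * y) []) := by
  induction m using Finsupp.induction_linear with
  | zero => simp
  | add m m' h h' => simp only [map_add, LinearMap.add_apply, h, h']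
  | single a c =>
    have : Finsupp.single a c = c • Finsupp.single a (1 : k) := by simp
    rw [this]
    simp only [map_smul, LinearMap.smul_apply, consLetter_single]
    rw [wordMul_ofWord, mulWord, mulWord]

omit hrep in
theorem wordMul_consLetter_nil (ρ : Representation k G (Letter r →₀ k)) (x y : G)
    (m : Letter r →₀ k) : wordMul ρ (consLetter r k m (ofWord r k x [])) (ofWord r k y []) =
      consLetter r k m (ofWord r k (x * y) []) := by
  induction m using Finsupp.induction_linear with
  | zero => simp
  | add m m' h h' => simp only [map_add, LinearMap.add_apply, h, h']
  | single a c =>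
    have : Finsupp.single a c = c • Finsupp.single a (1 : k) := by simp
    rw [this]
    simp only [map_smul, LinearMap.smul_apply, consLetter_single]
    rw [wordMul_ofWord, mulWord_nil_right]

namespace ModuleCollection

variable (N : ModuleCollection.{u, v, w} k rep r)

/-- The linear equivalence of `M_C` with the isotypic component. -/
def componentLinearEquiv (C : ConjClasses G) :
    N.M C ≃ₗ[k] (N.hopfStructure hrep).component (rep C) :=
  (N.basis C).equiv (componentBasis k r (hrep C)) (Equiv.refl _)

omit hrep in
theorem coe_componentBasis_equiv {C : ConjClasses G} {u : G} (h : ConjClasses.mk u = C)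
    (m : N.M C) : ((N.basis C).equiv (componentBasis k r h) (Equiv.refl _) m :
      PathCoalgebra k (HopfQuiver r)) = consLetter r k (N.embed h m) (ofWord r k 1 []) := by
  suffices H : (isotypic k (toVertex r u) (toVertex r 1)).subtype ∘ₗ
      ((N.basis C).equiv (componentBasis k r h) (Equiv.refl _)).toLinearMap =
      (consLetter r k).flip (ofWord r k 1 []) ∘ₗ N.embed h from LinearMap.congr_fun H m
  refine (N.basis C).ext fun j => ?_
  rw [LinearMap.comp_apply, LinearMap.comp_apply, embed_basis, LinearMap.flip_apply,
    consLetter_single, LinearEquiv.coe_coe, Module.Basis.equiv_apply]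
  exact componentBasis_apply h j

theorem coe_componentLinearEquiv (C : ConjClasses G) (m : N.M C) :
    Subtype.val (N.componentLinearEquiv hrep C m) =
      consLetter r k (N.embed (hrep C) m) (ofWord r k 1 []) :=
  N.coe_componentBasis_equiv (hrep C) m

/-- The isotypic components of the structure given by a collection of modules are these modules. -/
def componentEquiv (C : ConjClasses G) :
    N.M C ≃ₗ[(MonoidAlgebra k (Subgroup.centralizer {rep C}))ᵐᵒᵖ]
      (N.hopfStructure hrep).component (rep C) :=
  oppositeLinearEquiv (N.componentLinearEquiv hrep C) <| by
    intro z m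
    apply Subtype.ext
    rw [GradedHopfStructureOver.op_single_smul, one_smul]
    refine (N.coe_componentLinearEquiv hrep C _).trans ?_
    change _ = wordMul (N.letterRep hrep) (wordMul (N.letterRep hrep)
      (vertex k (toVertex r (z : G)⁻¹))
      (Subtype.val (N.componentLinearEquiv hrep C m)))
      (vertex k (toVertex r (z : G)))
    rw [coe_componentLinearEquiv, ← ofWord_nil, ← ofWord_nil, wordMul_nil_consLetter,
      wordMul_consLetter_nil, mul_one, inv_mul_cancel]
    have : N.letterRep hrep (z : G)⁻¹ (N.embed (hrep C) m) = _ := N.letterAct_embed _ (hrep C) m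
    rw [this]
    have hc : (z : G)⁻¹ * rep C * (z : G)⁻¹⁻¹ = rep C := by
      rw [inv_inv, mul_assoc, ← Subgroup.mem_centralizer_singleton_iff.1 z.2]
      simp
    refine congrArg (consLetter r k · _) (N.embed_congr _ _ hc.symm ?_)
    -- Both conjugators are 1 at the representative, so what remains is the left action of z⁻¹,
    -- which is the right action of z.
    rw [hc, conjugator_rep hrep, inv_one, one_mul, mul_one]
    have := N.leftAct_apply z⁻¹ m
    rw [inv_inv] at this
    exact this.symm

end ModuleCollection

end Induced

end

end HopfQuivers

namespace HopfQuivers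

noncomputable section

/-! ### Morphisms of graded Hopf algebra structures are determined in degree one -/

section DegreeOne

variable {k : Type u} [Field k] {G : Type v} [Group G] {r : ConjClasses G → ℕ}

/-- The projection of `kQ` onto `kQ₁`. -/
def projOne : PathCoalgebra k (HopfQuiver r) →ₗ[k] PathCoalgebra k (HopfQuiver r) :=
  wordLift k fun x w => match w with
    | [a] => ofWord r k x [a]
    | _ => 0

@[simp]
theorem projOne_nil (x : G) : projOne (ofWord r k x []) = 0 := by
  simp [projOne]

@[simp]
theorem projOne_singleton (x : G) (a : Letter r) :
    projOne (ofWord r k x [a]) = ofWord r k x [a] := by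
  simp [projOne]

@[simp]
theorem projOne_cons_cons (x : G) (a b : Letter r) (w : List (Letter r)) :
    projOne (ofWord r k x (a :: b :: w)) = 0 := by
  simp [projOne]

theorem projOne_of_mem {n : ℕ} {z : PathCoalgebra k (HopfQuiver r)}
    (hz : z ∈ degreePart k (HopfQuiver r) n) : projOne z = if n = 1 then z else 0 := by
  rw [degreePart_eq] at hz
  induction hz using Submodule.span_induction with
  | mem z hz =>
    obtain ⟨x, w, rfl, rfl⟩ := hz
    match w with
    | [] => simp
    | [a] => simp
    | a :: b :: w => simp
  | zero => simp
  | add z z' _ _ h h' => rw [map_add, h, h']; split_ifs <;> simp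
  | smul b z _ h => rw [map_smul, h]; split_ifs <;> simp

theorem projZero_of_mem_degreePart {n : ℕ} {z : PathCoalgebra k (HopfQuiver r)}
    (hz : z ∈ degreePart k (HopfQuiver r) n) :
    projZero k (HopfQuiver r) z = if n = 0 then z else 0 := by
  rw [degreePart_eq] at hz
  induction hz using Submodule.span_induction with
  | mem z hz =>
    obtain ⟨x, w, rfl, rfl⟩ := hz
    cases w <;> simp
  | zero => simp
  | add z z' _ _ h h' => rw [map_add, h, h']; split_ifs <;> simp
  | smul b z _ h => rw [map_smul, h]; split_ifs <;> simp

variable (k r) in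
/-- Splitting off the last arrow of the paths. -/
def splitArrow : PathCoalgebra k (HopfQuiver r) →ₗ[k]
    PathCoalgebra k (HopfQuiver r) ⊗[k] PathCoalgebra k (HopfQuiver r) :=
  projOne.rTensor _ ∘ₗ CoalgebraStruct.comul (R := k)

@[simp]
theorem splitArrow_nil (x : G) : splitArrow k r (ofWord r k x []) = 0 := by
  simp [splitArrow, comul_nil]

@[simp]
theorem splitArrow_cons (x : G) (a : Letter r) (w : List (Letter r)) :
    splitArrow k r (ofWord r k x (a :: w)) =
      ofWord r k (wordTarget x w) [a] ⊗ₜ ofWord r k x w := by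
  rw [splitArrow, LinearMap.comp_apply, comul_cons, map_add, LinearMap.rTensor_tmul, projOne_nil,
    TensorProduct.zero_tmul, zero_add, ← LinearMap.rTensor_comp_apply]
  cases w with
  | nil => simp [comul_nil, wordTarget]
  | cons b w =>
    have h : (projOne ∘ₗ consLetter r k (Finsupp.single a 1)) ∘ₗ
        consLetter r k (Finsupp.single b 1) = 0 := hom_ext_ofWord fun y v => by simp
    rw [comul_cons, map_add, LinearMap.rTensor_tmul, ← LinearMap.rTensor_comp_apply, h]
    simp

variable (k r) in
/-- The combination of letters given by an element of degree one. -/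
def arrowLetter : PathCoalgebra k (HopfQuiver r) →ₗ[k] (Letter r →₀ k) :=
  wordLift k fun _ w => match w with
    | [a] => Finsupp.single a 1
    | _ => 0

@[simp]
theorem arrowLetter_singleton (x : G) (a : Letter r) :
    arrowLetter k r (ofWord r k x [a]) = Finsupp.single a 1 := by
  simp [arrowLetter]

/-- `splitArrow` keeps the arrow with its source, `unconsLetter` only its letter. The former comes
from Δ and the grading alone, so it can be used with any Hopf structure. -/
theorem rTensor_arrowLetter_splitArrow (z : PathCoalgebra k (HopfQuiver r)) :
    (arrowLetter k r).rTensor _ (splitArrow k r z) = unconsLetter r k z := by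
  suffices h : (arrowLetter k r).rTensor _ ∘ₗ splitArrow k r = unconsLetter r k from
    LinearMap.congr_fun h z
  refine hom_ext_ofWord fun x w => ?_
  cases w <;> simp

theorem eq_of_splitArrow_eq {z z' : PathCoalgebra k (HopfQuiver r)}
    (h : splitArrow k r z = splitArrow k r z')
    (h' : projZero k (HopfQuiver r) z = projZero k (HopfQuiver r) z') : z = z' := by
  refine eq_of_unconsLetter_eq ?_ h'
  rw [← rTensor_arrowLetter_splitArrow, h, rTensor_arrowLetter_splitArrow]

theorem arrowLetter_mem {y x : G} {m : PathCoalgebra k (HopfQuiver r)}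
    (hm : m ∈ isotypic k (toVertex r y) (toVertex r x)) :
    arrowLetter k r m ∈ letterPart k r (y * x⁻¹) := by
  rw [isotypic_eq] at hm
  suffices h : Submodule.span k _ ≤ (letterPart k r (y * x⁻¹)).comap (arrowLetter k r) from h hm
  rw [Submodule.span_le]
  rintro _ ⟨a, rfl, rfl⟩
  simpa using single_mem_letterPart (k := k) a

theorem consLetter_comul {c g : G} {m : Letter r →₀ k} (hm : m ∈ letterPart k r c)
    {z : PathCoalgebra k (HopfQuiver r)} (hz : z ∈ targetPart k r g) :
    CoalgebraStruct.comul (R := k) (consLetter r k m z) =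
      ofWord r k (c * g) [] ⊗ₜ consLetter r k m z +
        (consLetter r k m).rTensor _ (CoalgebraStruct.comul (R := k) z) := by
  rw [comul_eq, leftCoaction_of_mem (consLetter_mem_targetPart hm hz)]
  simp

/-- `arrowLetter` forgets the source of `m`, but `z` ends at that source, so splitting after
appending restores it. -/
theorem splitArrow_consLetter {y x : G} {m : PathCoalgebra k (HopfQuiver r)}
    (hm : m ∈ isotypic k (toVertex r y) (toVertex r x)) {z : PathCoalgebra k (HopfQuiver r)}
    (hz : z ∈ targetPart k r x) :
    splitArrow k r (consLetter r k (arrowLetter k r m) z) = m ⊗ₜ z := by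
  rw [isotypic_eq] at hm
  induction hm, hz using Submodule.span_induction₂ with
  | mem_mem m z hm hz =>
    obtain ⟨a, -, rfl⟩ := hm
    obtain ⟨s, w, rfl, rfl⟩ := hz
    simp
  | zero_left => simp
  | zero_right => simp
  | add_left _ _ _ _ _ _ h h' =>
    simp only [map_add, LinearMap.add_apply, h, h', TensorProduct.add_tmul]
  | add_right _ _ _ _ _ _ h h' => simp only [map_add, h, h', TensorProduct.tmul_add]
  | smul_left _ _ _ _ _ h =>
    simp only [map_smul, LinearMap.smul_apply, h, TensorProduct.smul_tmul']
  | smul_right _ _ _ _ _ h => simp only [map_smul, h, TensorProduct.tmul_smul]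

end DegreeOne

/-! ### Extending a map on arrows to a coalgebra map -/

section Extension

variable {k : Type u} [Field k] {G : Type v} [Group G] {r : ConjClasses G → ℕ}

/-- The extension of a map on `kQ₁` to the paths. -/
def extendWord (f : PathCoalgebra k (HopfQuiver r) →ₗ[k] PathCoalgebra k (HopfQuiver r)) (x : G) :
    List (Letter r) → PathCoalgebra k (HopfQuiver r)
  | [] => ofWord r k x []
  | a :: w => consLetter r k (arrowLetter k r (f (ofWord r k (wordTarget x w) [a])))
      (extendWord f x w)

/-- The extension of a map on `kQ₁` to `kQ`. -/
def extendHom (f : PathCoalgebra k (HopfQuiver r) →ₗ[k] PathCoalgebra k (HopfQuiver r)) :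
    PathCoalgebra k (HopfQuiver r) →ₗ[k] PathCoalgebra k (HopfQuiver r) :=
  wordLift k (extendWord f)

variable (f : PathCoalgebra k (HopfQuiver r) →ₗ[k] PathCoalgebra k (HopfQuiver r))

@[simp]
theorem extendHom_nil (x : G) : extendHom f (ofWord r k x []) = ofWord r k x [] := by
  rw [extendHom, wordLift_ofWord, extendWord]

theorem extendHom_cons (x : G) (a : Letter r) (w : List (Letter r)) :
    extendHom f (ofWord r k x (a :: w)) =
      consLetter r k (arrowLetter k r (f (ofWord r k (wordTarget x w) [a])))
        (extendHom f (ofWord r k x w)) := by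
  simp only [extendHom, wordLift_ofWord, extendWord]

theorem projZero_extendHom (z : PathCoalgebra k (HopfQuiver r)) :
    projZero k (HopfQuiver r) (extendHom f z) = extendHom f (projZero k (HopfQuiver r) z) := by
  suffices h : projZero k (HopfQuiver r) ∘ₗ extendHom f =
      extendHom f ∘ₗ projZero k (HopfQuiver r) from LinearMap.congr_fun h z
  refine hom_ext_ofWord fun x w => ?_
  cases w <;> simp [extendHom_cons]

theorem counit_extendHom (z : PathCoalgebra k (HopfQuiver r)) :
    CoalgebraStruct.counit (R := k) (extendHom f z) = CoalgebraStruct.counit (R := k) z := by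
  suffices h : CoalgebraStruct.counit (R := k) ∘ₗ extendHom f =
      CoalgebraStruct.counit (R := k) from LinearMap.congr_fun h z
  refine hom_ext_ofWord fun x w => ?_
  rw [LinearMap.comp_apply, ← counit_projZero, projZero_extendHom]
  cases w <;> simp [counit_cons]

theorem extendHom_mem {n : ℕ} {z : PathCoalgebra k (HopfQuiver r)}
    (hz : z ∈ degreePart k (HopfQuiver r) n) :
    extendHom f z ∈ degreePart k (HopfQuiver r) n := by
  rw [degreePart_eq] at hz
  refine (Submodule.span_le (p := Submodule.comap (extendHom f)
    (degreePart k (HopfQuiver r) n))).2 ?_ hz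
  rintro _ ⟨x, w, rfl, rfl⟩
  clear hz
  change extendHom f _ ∈ degreePart k (HopfQuiver r) _
  induction w with
  | nil => rw [extendHom_nil]; exact ofWord_mem (r := r) x []
  | cons a w ih =>
    rw [extendHom_cons]
    exact consLetter_mem _ ih

variable {f} (hf : ∀ (y x : G), ∀ m ∈ isotypic k (toVertex r y) (toVertex r x),
  f m ∈ isotypic k (toVertex r y) (toVertex r x))

theorem ofWord_mem_isotypic (x : G) (a : Letter r) :
    ofWord r k x [a] ∈ isotypic k (toVertex r (a.1 * x)) (toVertex r x) := by
  rw [isotypic_eq]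
  exact Submodule.subset_span ⟨a, rfl, rfl⟩

include hf

/-- As `f` preserves the sources and targets of arrows, the images of consecutive arrows still
compose. -/
theorem extendHom_mem_targetPart (x : G) (w : List (Letter r)) :
    extendHom f (ofWord r k x w) ∈ targetPart k r (wordTarget x w) := by
  induction w with
  | nil => rw [extendHom_nil]; exact ofWord_mem_targetPart (r := r) x []
  | cons a w ih =>
    rw [extendHom_cons]
    have h := arrowLetter_mem (hf _ _ _ (ofWord_mem_isotypic (k := k) (wordTarget x w) a))
    have := consLetter_mem_targetPart h ih
    rwa [mul_inv_cancel_right] at this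

theorem leftCoaction_extendHom (x : G) (w : List (Letter r)) :
    leftCoaction k (HopfQuiver r) (extendHom f (ofWord r k x w)) =
      ofWord r k (wordTarget x w) [] ⊗ₜ extendHom f (ofWord r k x w) :=
  leftCoaction_of_mem (extendHom_mem_targetPart hf x w)

/-- With its values on vertices, this property characterizes the extension; it drives the inductions
for inverses and for products. -/
theorem splitArrow_extendHom (z : PathCoalgebra k (HopfQuiver r)) :
    splitArrow k r (extendHom f z) = TensorProduct.map f (extendHom f) (splitArrow k r z) := by
  suffices h : splitArrow k r ∘ₗ extendHom f =
      TensorProduct.map f (extendHom f) ∘ₗ splitArrow k r from LinearMap.congr_fun h z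
  refine hom_ext_ofWord fun x w => ?_
  cases w with
  | nil => simp
  | cons a w =>
    rw [LinearMap.comp_apply, LinearMap.comp_apply, extendHom_cons,
      splitArrow_consLetter (hf _ _ _ (ofWord_mem_isotypic (k := k) (wordTarget x w) a))
        (extendHom_mem_targetPart hf x w), splitArrow_cons, TensorProduct.map_tmul]

theorem comul_extendHom (z : PathCoalgebra k (HopfQuiver r)) :
    CoalgebraStruct.comul (R := k) (extendHom f z) =
      TensorProduct.map (extendHom f) (extendHom f) (CoalgebraStruct.comul (R := k) z) := by
  suffices h : CoalgebraStruct.comul (R := k) ∘ₗ extendHom f =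
      TensorProduct.map (extendHom f) (extendHom f) ∘ₗ CoalgebraStruct.comul (R := k) from
    LinearMap.congr_fun h z
  refine hom_ext_ofWord fun x w => ?_
  simp only [LinearMap.comp_apply]
  induction w with
  | nil => simp [comul_nil]
  | cons a w ih =>
    have hm := arrowLetter_mem (hf _ _ _ (ofWord_mem_isotypic (k := k) (wordTarget x w) a))
    rw [extendHom_cons, consLetter_comul hm (extendHom_mem_targetPart hf x w),
      mul_inv_cancel_right, comul_cons, map_add, TensorProduct.map_tmul, extendHom_nil,
      ← extendHom_cons, ih]
    refine congrArg (_ + ·) ?_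
    -- Every left leg of Δ of the shorter path ends where that path ends. Hence the last arrow has
    -- the same source in all terms, and `f` sends it to the same combination of letters.
    suffices h : targetPart₂ k r (wordTarget x w) ≤ LinearMap.eqLocus
        ((consLetter r k (arrowLetter k r (f (ofWord r k (wordTarget x w) [a])))).rTensor _ ∘ₗ
          TensorProduct.map (extendHom f) (extendHom f))
        (TensorProduct.map (extendHom f) (extendHom f) ∘ₗ
          (consLetter r k (Finsupp.single a 1)).rTensor _) from h (comul_mem_targetPart₂ x w)
    rw [targetPart₂, Submodule.span_le]
    rintro _ ⟨p, hp, q, rfl⟩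
    simp only [SetLike.mem_coe, LinearMap.mem_eqLocus, LinearMap.comp_apply,
      TensorProduct.map_tmul, LinearMap.rTensor_tmul]
    congr 1
    induction hp using Submodule.span_induction with
    | mem p hp =>
      obtain ⟨y, v, hv, rfl⟩ := hp
      rw [consLetter_single, extendHom_cons, hv]
    | zero => simp
    | add _ _ _ _ h h' => simp only [map_add, h, h']
    | smul _ _ _ h => simp only [map_smul, h]

theorem extendHom_extendHom
    {g : PathCoalgebra k (HopfQuiver r) →ₗ[k] PathCoalgebra k (HopfQuiver r)}
    (hg : ∀ (y x : G), ∀ m ∈ isotypic k (toVertex r y) (toVertex r x),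
      g m ∈ isotypic k (toVertex r y) (toVertex r x))
    (hgf : ∀ (y x : G), ∀ m ∈ isotypic k (toVertex r y) (toVertex r x), g (f m) = m)
    (z : PathCoalgebra k (HopfQuiver r)) : extendHom g (extendHom f z) = z := by
  suffices h : extendHom g ∘ₗ extendHom f = LinearMap.id from LinearMap.congr_fun h z
  refine hom_ext_ofWord fun x w => ?_
  simp only [LinearMap.comp_apply, LinearMap.id_apply]
  induction w with
  | nil => simp
  | cons a w ih =>
    refine eq_of_splitArrow_eq ?_ ?_
    · rw [splitArrow_extendHom hg, splitArrow_extendHom hf, splitArrow_cons,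
        TensorProduct.map_tmul, TensorProduct.map_tmul, ih,
        hgf _ _ _ (ofWord_mem_isotypic _ a)]
    · simp [projZero_extendHom]

end Extension

/-! ### Multiplicativity of the extension in arbitrary structures -/

section Morphisms

variable {k : Type u} [Field k] {G : Type v} [Group G] {r : ConjClasses G → ℕ}

namespace GradedHopfStructureOver

variable (H H' : GradedHopfStructureOver k r)

theorem mul_nil (x y : G) :
    H.mul (ofWord r k x []) (ofWord r k y []) = ofWord r k (x * y) [] := by
  rw [ofWord_nil, ofWord_nil, ofWord_nil]
  exact H.mul_vertex x y

theorem mul_ofWord_mem (x y : G) (w v : List (Letter r)) :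
    H.mul (ofWord r k x w) (ofWord r k y v) ∈
      degreePart k (HopfQuiver r) (w.length + v.length) :=
  H.mul_mem _ _ _ _ (ofWord_mem x w) (ofWord_mem y v)

theorem projZero_mul (a b : PathCoalgebra k (HopfQuiver r)) :
    projZero k (HopfQuiver r) (H.mul a b) =
      H.mul (projZero k (HopfQuiver r) a) (projZero k (HopfQuiver r) b) := by
  suffices h : H.mul.compr₂ (projZero k (HopfQuiver r)) =
      H.mul.compl₁₂ (projZero k (HopfQuiver r)) (projZero k (HopfQuiver r)) from
    LinearMap.congr_fun₂ h a b
  refine hom_ext_ofWord fun x w => hom_ext_ofWord fun y v => ?_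
  simp only [LinearMap.compr₂_apply, LinearMap.compl₁₂_apply]
  rw [projZero_of_mem_degreePart (H.mul_ofWord_mem x y w v)]
  cases w <;> cases v <;> simp

/-- By the grading, degree one arises only from the degrees (1, 0) and (0, 1). -/
theorem projOne_mul (a b : PathCoalgebra k (HopfQuiver r)) :
    projOne (H.mul a b) = H.mul (projOne a) (projZero k (HopfQuiver r) b) +
      H.mul (projZero k (HopfQuiver r) a) (projOne b) := by
  suffices h : H.mul.compr₂ projOne =
      H.mul.compl₁₂ projOne (projZero k (HopfQuiver r)) +
        H.mul.compl₁₂ (projZero k (HopfQuiver r)) projOne from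
    LinearMap.congr_fun₂ h a b
  refine hom_ext_ofWord fun x w => hom_ext_ofWord fun y v => ?_
  simp only [LinearMap.compr₂_apply, LinearMap.compl₁₂_apply, LinearMap.add_apply]
  rw [projOne_of_mem (H.mul_ofWord_mem x y w v)]
  match w, v with
  | [], [] => simp
  | [], [b] => simp
  | [], b :: c :: v => simp
  | [a], [] => simp
  | a :: a' :: w, [] => simp
  | a :: w, b :: v =>
    rw [if_neg (by simp only [List.length_cons]; omega)]
    simp

/-- The multiplication of `kQ ⊗ kQ`. -/
abbrev mul₂ : PathCoalgebra k (HopfQuiver r) ⊗[k] PathCoalgebra k (HopfQuiver r) →ₗ[k]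
    PathCoalgebra k (HopfQuiver r) ⊗[k] PathCoalgebra k (HopfQuiver r) →ₗ[k]
      PathCoalgebra k (HopfQuiver r) ⊗[k] PathCoalgebra k (HopfQuiver r) :=
  TensorProduct.map₂ H.mul H.mul

theorem mul₂_tmul (a b c d : PathCoalgebra k (HopfQuiver r)) :
    H.mul₂ (a ⊗ₜ b) (c ⊗ₜ d) = H.mul a c ⊗ₜ H.mul b d := rfl

theorem rTensor_projOne_mul₂
    (X Y : PathCoalgebra k (HopfQuiver r) ⊗[k] PathCoalgebra k (HopfQuiver r)) :
    projOne.rTensor _ (H.mul₂ X Y) =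
      H.mul₂ (projOne.rTensor _ X) ((projZero k (HopfQuiver r)).rTensor _ Y) +
        H.mul₂ ((projZero k (HopfQuiver r)).rTensor _ X) (projOne.rTensor _ Y) := by
  induction X with
  | zero => simp
  | add _ _ h h' =>
    simp only [map_add, LinearMap.add_apply, h, h']
    abel
  | tmul p q =>
    induction Y with
    | zero => simp
    | add _ _ h h' =>
      simp only [map_add, h, h']
      abel
    | tmul p' q' =>
      simp only [mul₂_tmul, LinearMap.rTensor_tmul, projOne_mul, TensorProduct.add_tmul]

/-- Δ is multiplicative, and `projOne_mul` applies to the first leg. The first legs on the right are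
then products of an arrow with a vertex, so the multiplication is determined recursively by kQ₀ and
the bimodule kQ₁. -/
theorem splitArrow_mul (a b : PathCoalgebra k (HopfQuiver r)) :
    splitArrow k r (H.mul a b) =
      H.mul₂ (splitArrow k r a) (leftCoaction k (HopfQuiver r) b) +
        H.mul₂ (leftCoaction k (HopfQuiver r) a) (splitArrow k r b) := by
  rw [splitArrow, LinearMap.comp_apply, H.comul_mul, rTensor_projOne_mul₂, leftCoaction_eq,
    leftCoaction_eq]
  rfl

/-- Multiplication by elements of the group from both sides. -/
def bimul (g h : G) : PathCoalgebra k (HopfQuiver r) →ₗ[k] PathCoalgebra k (HopfQuiver r) :=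
  H.mul.flip (ofWord r k h []) ∘ₗ H.mul (ofWord r k g [])

theorem bimul_apply (g h : G) (m : PathCoalgebra k (HopfQuiver r)) :
    H.bimul g h m = H.mul (H.mul (ofWord r k g []) m) (ofWord r k h []) := rfl

theorem bimul_bimul (g h g' h' : G) (m : PathCoalgebra k (HopfQuiver r)) :
    H.bimul g h (H.bimul g' h' m) = H.bimul (g * g') (h' * h) m := by
  rw [bimul_apply, bimul_apply, bimul_apply, ← H.mul_nil g g', ← H.mul_nil h' h]
  simp only [H.mul_assoc]

theorem one_eq : H.one = ofWord r k 1 [] := by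
  rw [ofWord_nil]
  exact H.one_eq_vertex

theorem bimul_one_right (g : G) (m : PathCoalgebra k (HopfQuiver r)) :
    H.bimul g 1 m = H.mul (ofWord r k g []) m := by
  rw [bimul_apply, ← one_eq, H.mul_one]

theorem bimul_one_left (h : G) (m : PathCoalgebra k (HopfQuiver r)) :
    H.bimul 1 h m = H.mul m (ofWord r k h []) := by
  rw [bimul_apply, ← one_eq, H.one_mul]

theorem bimul_one_one (m : PathCoalgebra k (HopfQuiver r)) : H.bimul 1 1 m = m := by
  rw [bimul_one_left, ← one_eq, H.mul_one]

/-- Vertices are group-like, so multiplying by them keeps an element skew-primitive and multiplies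
both of its end points. -/
theorem bimul_mem {y x : G} (g h : G) {m : PathCoalgebra k (HopfQuiver r)}
    (hm : m ∈ isotypic k (toVertex r y) (toVertex r x)) :
    H.bimul g h m ∈ isotypic k (toVertex r (g * y * h)) (toVertex r (g * x * h)) := by
  rw [mem_isotypic_iff] at hm ⊢
  obtain ⟨h1, h2⟩ := hm
  constructor
  · have := H.mul_mem _ _ _ _ (H.mul_mem _ _ _ _ (ofWord_mem g []) h1) (ofWord_mem h [])
    simpa [bimul_apply] using this
  · simp only [bimul_apply, H.comul_mul, comul_nil, h2, map_add, LinearMap.add_apply,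
      TensorProduct.map₂_apply_tmul, TensorProduct.map_tmul, ← ofWord_nil, mul_nil]

/-- A map that commutes in degree one with the multiplication by the elements of the group from
both sides, and preserves the isotypic components, extends to a multiplicative map. -/
theorem extendHom_mul
    {f : PathCoalgebra k (HopfQuiver r) →ₗ[k] PathCoalgebra k (HopfQuiver r)}
    (hf : ∀ (y x : G), ∀ m ∈ isotypic k (toVertex r y) (toVertex r x),
      f m ∈ isotypic k (toVertex r y) (toVertex r x))
    (hbi : ∀ (g h y x : G), ∀ m ∈ isotypic k (toVertex r y) (toVertex r x),
      f (H.bimul g h m) = H'.bimul g h (f m)) (a b : PathCoalgebra k (HopfQuiver r)) :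
    extendHom f (H.mul a b) = H'.mul (extendHom f a) (extendHom f b) := by
  suffices h : H.mul.compr₂ (extendHom f) = H'.mul.compl₁₂ (extendHom f) (extendHom f) from
    LinearMap.congr_fun₂ h a b
  refine hom_ext_ofWord fun x w => hom_ext_ofWord fun y v => ?_
  simp only [LinearMap.compr₂_apply, LinearMap.compl₁₂_apply]
  induction hn : w.length + v.length using Nat.strong_induction_on generalizing w v with
  | _ n ih =>
    refine eq_of_splitArrow_eq ?_ ?_
    · rw [splitArrow_extendHom hf, splitArrow_mul, splitArrow_mul, leftCoaction_extendHom hf,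
        leftCoaction_extendHom hf, splitArrow_extendHom hf, splitArrow_extendHom hf,
        leftCoaction_ofWord, leftCoaction_ofWord, map_add]
      congr 1
      -- The last arrow comes from the left factor and is multiplied by a vertex on the right, so
      -- `hbi` treats the first leg and induction the second; the other summand is symmetric.
      · cases w with
        | nil => simp
        | cons a w =>
          rw [splitArrow_cons, mul₂_tmul, TensorProduct.map_tmul, TensorProduct.map_tmul,
            mul₂_tmul, ih _ (by rw [← hn]; simp) w v rfl, ← bimul_one_left, ← bimul_one_left,
            hbi _ _ _ _ _ (ofWord_mem_isotypic _ a)]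
      · cases v with
        | nil => simp
        | cons b v =>
          rw [splitArrow_cons, mul₂_tmul, TensorProduct.map_tmul, TensorProduct.map_tmul,
            mul₂_tmul, ih _ (by rw [← hn]; simp) w v rfl, ← bimul_one_right, ← bimul_one_right,
            hbi _ _ _ _ _ (ofWord_mem_isotypic _ b)]
    · rw [projZero_extendHom, projZero_mul, projZero_mul, projZero_extendHom, projZero_extendHom]
      cases w <;> cases v <;> simp [mul_nil]

variable {H H'}

/-- Mutually inverse isomorphisms of the Hopf bimodules in degree one extend to an isomorphism of
graded Hopf algebras. -/
theorem isomorphic_of_degreeOne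
    {f g : PathCoalgebra k (HopfQuiver r) →ₗ[k] PathCoalgebra k (HopfQuiver r)}
    (hf : ∀ (y x : G), ∀ m ∈ isotypic k (toVertex r y) (toVertex r x),
      f m ∈ isotypic k (toVertex r y) (toVertex r x))
    (hg : ∀ (y x : G), ∀ m ∈ isotypic k (toVertex r y) (toVertex r x),
      g m ∈ isotypic k (toVertex r y) (toVertex r x))
    (hgf : ∀ (y x : G), ∀ m ∈ isotypic k (toVertex r y) (toVertex r x), g (f m) = m)
    (hfg : ∀ (y x : G), ∀ m ∈ isotypic k (toVertex r y) (toVertex r x), f (g m) = m)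
    (hbi : ∀ (g h y x : G), ∀ m ∈ isotypic k (toVertex r y) (toVertex r x),
      f (H.bimul g h m) = H'.bimul g h (f m)) : Isomorphic H H' := by
  let e' : H.Carrier ≃ₐc[k] H'.Carrier :=
    { (show H.Carrier →ₗ[k] H'.Carrier from extendHom f) with
      invFun := extendHom g
      left_inv := extendHom_extendHom hf hg hgf
      right_inv := extendHom_extendHom hg hf hfg
      counit_comp := LinearMap.ext (counit_extendHom f)
      map_comp_comul := LinearMap.ext fun z => (comul_extendHom hf z).symm
      map_mul' := extendHom_mul H H' hf hbi }
  refine ⟨e', fun n z => ⟨fun hz => extendHom_mem f hz, fun hz => ?_⟩, fun x => ?_⟩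
  · have := extendHom_mem g hz
    exact (extendHom_extendHom hf hg hgf z) ▸ this
  · have := extendHom_nil f x
    rw [ofWord_nil] at this
    exact this

end GradedHopfStructureOver

end Morphisms

end

end HopfQuivers

namespace HopfQuivers

noncomputable section

/-! ### Graded Hopf algebra structures are determined by their isotypic components -/

section Transport

variable {k : Type u} [Field k] {G : Type v} [Group G] {r : ConjClasses G → ℕ}
  {rep : ConjClasses G → G}

namespace GradedHopfStructureOver

variable (rep) in
/-- The map on `kQ₁` that is given by maps on the isotypic components `ᵘ(kQ₁)¹`. -/
def transport (H H' : GradedHopfStructureOver k r)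
    (φ : ConjClasses G → PathCoalgebra k (HopfQuiver r) →ₗ[k] PathCoalgebra k (HopfQuiver r)) :
    PathCoalgebra k (HopfQuiver r) →ₗ[k] PathCoalgebra k (HopfQuiver r) :=
  wordLift k fun x w => match w with
    -- For t the conjugator of the letter's degree, t⁻¹ m x⁻¹ t has source 1 and the representative
    -- as target. There `φ` applies, and the outer `bimul` moves the result back.
    | [a] => H'.bimul (conjugator rep a.1) ((conjugator rep a.1)⁻¹ * x)
        (φ (ConjClasses.mk a.1)
          (H.bimul (conjugator rep a.1)⁻¹ (x⁻¹ * conjugator rep a.1) (ofWord r k x [a])))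
    | _ => 0

variable {H H' : GradedHopfStructureOver k r}
  {φ : ConjClasses G → PathCoalgebra k (HopfQuiver r) →ₗ[k] PathCoalgebra k (HopfQuiver r)}

/-- All arrows from x to y have the same letter degree c, so one formula holds on the whole isotypic
component. -/
theorem transport_apply {c y x : G} (hc : c * x = y) {m : PathCoalgebra k (HopfQuiver r)}
    (hm : m ∈ isotypic k (toVertex r y) (toVertex r x)) :
    transport rep H H' φ m =
      H'.bimul (conjugator rep c) ((conjugator rep c)⁻¹ * x)
        (φ (ConjClasses.mk c)
          (H.bimul (conjugator rep c)⁻¹ (x⁻¹ * conjugator rep c) m)) := by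
  subst hc
  rw [isotypic_eq] at hm
  refine LinearMap.mem_eqLocus.1 ((Submodule.span_le (p := LinearMap.eqLocus
    (transport rep H H' φ) (H'.bimul (conjugator rep c) ((conjugator rep c)⁻¹ * x) ∘ₗ
      φ (ConjClasses.mk c) ∘ₗ H.bimul (conjugator rep c)⁻¹ (x⁻¹ * conjugator rep c)))).2 ?_ hm)
  rintro _ ⟨a, ha, rfl⟩
  obtain rfl := mul_right_cancel ha
  simp [transport]

variable (hrep : ∀ C, ConjClasses.mk (rep C) = C)
include hrep

theorem bimul_conjugator_mem (H : GradedHopfStructureOver k r) {c y x : G} (hc : c * x = y)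
    {m : PathCoalgebra k (HopfQuiver r)}
    (hm : m ∈ isotypic k (toVertex r y) (toVertex r x)) :
    H.bimul (conjugator rep c)⁻¹ (x⁻¹ * conjugator rep c) m ∈
      isotypic k (toVertex r (rep (ConjClasses.mk c))) (toVertex r 1) := by
  have := H.bimul_mem (conjugator rep c)⁻¹ (x⁻¹ * conjugator rep c) hm
  have h1 : (conjugator rep c)⁻¹ * y * (x⁻¹ * conjugator rep c) = rep (ConjClasses.mk c) := by
    have h := conjugator_spec hrep c
    generalize conjugator rep c = t at *
    calc t⁻¹ * y * (x⁻¹ * t) = t⁻¹ * c * t := by rw [← hc]; group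
      _ = t⁻¹ * (t * rep (ConjClasses.mk c) * t⁻¹) * t := by rw [h]
      _ = _ := by group
  have h2 : (conjugator rep c)⁻¹ * x * (x⁻¹ * conjugator rep c) = 1 := by group
  rwa [h1, h2] at this

theorem transport_mem
    (hφ : ∀ C, ∀ m ∈ isotypic k (toVertex r (rep C)) (toVertex r 1),
      φ C m ∈ isotypic k (toVertex r (rep C)) (toVertex r 1))
    (y x : G) (m : PathCoalgebra k (HopfQuiver r))
    (hm : m ∈ isotypic k (toVertex r y) (toVertex r x)) :
    transport rep H H' φ m ∈ isotypic k (toVertex r y) (toVertex r x) := by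
  have hc : y * x⁻¹ * x = y := by group
  rw [transport_apply hc hm]
  have := H'.bimul_mem (conjugator rep (y * x⁻¹)) ((conjugator rep (y * x⁻¹))⁻¹ * x)
    (hφ _ _ (bimul_conjugator_mem hrep H hc hm))
  have h1 : conjugator rep (y * x⁻¹) * rep (ConjClasses.mk (y * x⁻¹)) *
      ((conjugator rep (y * x⁻¹))⁻¹ * x) = y := by
    rw [← mul_assoc, conjugator_spec hrep, hc]
  have h2 : conjugator rep (y * x⁻¹) * 1 * ((conjugator rep (y * x⁻¹))⁻¹ * x) = x := by group
  rwa [h1, h2] at this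

theorem transport_transport
    {ψ : ConjClasses G → PathCoalgebra k (HopfQuiver r) →ₗ[k] PathCoalgebra k (HopfQuiver r)}
    (hφ : ∀ C, ∀ m ∈ isotypic k (toVertex r (rep C)) (toVertex r 1),
      φ C m ∈ isotypic k (toVertex r (rep C)) (toVertex r 1))
    (hψ : ∀ C, ∀ m ∈ isotypic k (toVertex r (rep C)) (toVertex r 1), ψ C (φ C m) = m)
    (y x : G) (m : PathCoalgebra k (HopfQuiver r))
    (hm : m ∈ isotypic k (toVertex r y) (toVertex r x)) :
    transport rep H' H ψ (transport rep H H' φ m) = m := by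
  have hc : y * x⁻¹ * x = y := by group
  rw [transport_apply hc (transport_mem hrep hφ y x m hm), transport_apply hc hm, bimul_bimul]
  have h1 : ∀ t : G, t⁻¹ * t = 1 := fun t => by group
  have h2 : ∀ t : G, t⁻¹ * x * (x⁻¹ * t) = 1 := fun t => by group
  rw [h1, h2, bimul_one_one, hψ _ _ (bimul_conjugator_mem hrep H hc hm), bimul_bimul]
  have h3 : ∀ t : G, x⁻¹ * t * (t⁻¹ * x) = 1 := fun t => by group
  rw [h3, mul_inv_cancel, bimul_one_one]

/-- Passing from m to g m h replaces the conjugator t by t', which changes the element at the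
representative by conjugation with t'⁻¹ g t. That element centralizes the representative, so `φ`
respects the change. -/
theorem transport_bimul
    (hφ : ∀ C, ∀ z ∈ Subgroup.centralizer {rep C},
      ∀ m ∈ isotypic k (toVertex r (rep C)) (toVertex r 1),
        φ C (H.bimul z z⁻¹ m) = H'.bimul z z⁻¹ (φ C m))
    (g h y x : G) (m : PathCoalgebra k (HopfQuiver r))
    (hm : m ∈ isotypic k (toVertex r y) (toVertex r x)) :
    transport rep H H' φ (H.bimul g h m) = H'.bimul g h (transport rep H H' φ m) := by
  obtain ⟨c, hc⟩ : ∃ c, c * x = y := ⟨y * x⁻¹, by group⟩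
  have hc' : g * c * g⁻¹ * (g * x * h) = g * y * h := by rw [← hc]; group
  rw [transport_apply hc' (H.bimul_mem g h hm), transport_apply hc hm, mk_conj rfl g]
  have hn := bimul_conjugator_mem hrep H hc hm
  have hz := conjugator_mem hrep (c := c) rfl (g := g) rfl
  generalize conjugator rep (g * c * g⁻¹) = t' at *
  generalize conjugator rep c = t at *
  have key := hφ _ _ hz _ hn
  rw [bimul_bimul] at key
  rw [bimul_bimul, bimul_bimul]
  have h1 : t'⁻¹ * g * t * t⁻¹ = t'⁻¹ * g := by group
  have h2 : x⁻¹ * t * (t'⁻¹ * g * t)⁻¹ = h * ((g * x * h)⁻¹ * t') := by group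
  rw [h1, h2] at key
  rw [key, bimul_bimul]
  congr 2
  · group
  · group

/-- Structures whose isotypic components are isomorphic are isomorphic. -/
theorem isomorphic_of_components (e : ∀ C, H.component (rep C)
      ≃ₗ[(MonoidAlgebra k (Subgroup.centralizer {rep C}))ᵐᵒᵖ] H'.component (rep C)) :
    Isomorphic H H' := by
  -- The extension to all of kQ is arbitrary; only its values on the component matter.
  have extend : ∀ {K K' : GradedHopfStructureOver k r} (e : ∀ C, K.component (rep C)
      ≃ₗ[(MonoidAlgebra k (Subgroup.centralizer {rep C}))ᵐᵒᵖ] K'.component (rep C)) (C),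
      ∃ φ : PathCoalgebra k (HopfQuiver r) →ₗ[k] PathCoalgebra k (HopfQuiver r),
        ∀ (m) (hm : m ∈ K.component (rep C)), φ m = Subtype.val (e C ⟨m, hm⟩) := by
    intro K K' e C
    obtain ⟨φ, hφ⟩ := LinearMap.exists_extend
      ((K'.component (rep C)).subtype ∘ₗ ((e C).restrictScalars k).toLinearMap)
    exact ⟨φ, fun m hm => LinearMap.congr_fun hφ ⟨m, hm⟩⟩
  choose φ hφ using extend e
  choose ψ hψ using extend fun C => (e C).symm
  have hφ' : ∀ C, ∀ m ∈ isotypic k (toVertex r (rep C)) (toVertex r 1),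
      φ C m ∈ isotypic k (toVertex r (rep C)) (toVertex r 1) := fun C m hm => by
    rw [hφ C m hm]
    exact (e C ⟨m, hm⟩).2
  have hψ' : ∀ C, ∀ m ∈ isotypic k (toVertex r (rep C)) (toVertex r 1),
      ψ C m ∈ isotypic k (toVertex r (rep C)) (toVertex r 1) := fun C m hm => by
    rw [hψ C m hm]
    exact ((e C).symm ⟨m, hm⟩).2
  have hψφ : ∀ C, ∀ m ∈ isotypic k (toVertex r (rep C)) (toVertex r 1), ψ C (φ C m) = m :=
    fun C m hm => by
      rw [hψ C _ (hφ' C m hm)]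
      exact (congrArg (fun n => Subtype.val ((e C).symm n)) (Subtype.ext (hφ C m hm))).trans
        (congrArg Subtype.val ((e C).symm_apply_apply ⟨m, hm⟩))
  have hφψ : ∀ C, ∀ m ∈ isotypic k (toVertex r (rep C)) (toVertex r 1), φ C (ψ C m) = m :=
    fun C m hm => by
      rw [hφ C _ (hψ' C m hm)]
      exact (congrArg (fun n => Subtype.val (e C n)) (Subtype.ext (hψ C m hm))).trans
        (congrArg Subtype.val ((e C).apply_symm_apply ⟨m, hm⟩))
  have bimul_eq : ∀ (K : GradedHopfStructureOver k r) (C)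
      (z : Subgroup.centralizer {rep C}) (m : K.component (rep C)),
      K.bimul (z : G) (z : G)⁻¹ (Subtype.val m) = Subtype.val
        (MulOpposite.op (MonoidAlgebra.single z⁻¹ (1 : k)) • m) := fun K C z m => by
    refine Eq.trans ?_ (K.op_single_smul (rep C) z⁻¹ 1 m).symm
    rw [one_smul, InvMemClass.coe_inv, inv_inv, bimul_apply, ofWord_nil, ofWord_nil]
    rfl
  refine isomorphic_of_degreeOne (f := transport rep H H' φ) (g := transport rep H' H ψ)
    (transport_mem hrep hφ') (transport_mem hrep hψ') (transport_transport hrep hφ' hψφ)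
    (transport_transport hrep hψ' hφψ) (transport_bimul hrep fun C z hz m hm => ?_)
  have h1 := bimul_eq H C ⟨z, hz⟩ ⟨m, hm⟩
  have h2 := bimul_eq H' C ⟨z, hz⟩ (e C ⟨m, hm⟩)
  rw [← map_smul, ← hφ C m hm] at h2
  refine Eq.trans ?_ h2.symm
  refine (congrArg (φ C) h1).trans ?_
  exact hφ C _ _

omit hrep in
/-- Isomorphic structures have isomorphic isotypic components. -/
theorem Isomorphic.components (h : Isomorphic H H') (u : G) :
    Nonempty (H.component u ≃ₗ[(MonoidAlgebra k (Subgroup.centralizer {u}))ᵐᵒᵖ]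
      H'.component u) := by
  obtain ⟨f, h1, h2⟩ := h
  -- Components are cut out by the degree, Δ and the vertices, all of which the isomorphism
  -- respects. Stated for arbitrary structures so that it also applies to the inverse.
  have hf : ∀ {K K' : GradedHopfStructureOver k r} (f : K.Carrier ≃ₐc[k] K'.Carrier),
      (∀ n x, x ∈ K.degree n ↔ f x ∈ K'.degree n) → (∀ g, f (K.grp g) = K'.grp g) →
      ∀ m ∈ K.component u, f m ∈ K'.component u := by
    intro K K' f h1 h2 m hm
    rw [mem_component_iff] at hm ⊢
    refine ⟨(h1 1 m).1 hm.1, ?_⟩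
    rw [← CoalgHomClass.map_comp_comul_apply, hm.2, map_add, TensorProduct.map_tmul,
      TensorProduct.map_tmul]
    simp [h2]
  have hf' : ∀ m ∈ H'.component u, f.symm m ∈ H.component u := by
    refine hf f.symm (fun n x => ?_) fun g => ?_
    · rw [h1 n, BialgEquiv.apply_symm_apply]
    · rw [← h2 g, BialgEquiv.symm_apply_apply]
  let e : H.component u ≃ₗ[k] H'.component u :=
    { toFun m := ⟨f m, hf f h1 h2 m m.2⟩
      invFun m := ⟨f.symm m, hf' m m.2⟩
      map_add' m m' := Subtype.ext (map_add f (m : H.Carrier) m')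
      map_smul' c m := Subtype.ext (map_smul f c (m : H.Carrier))
      left_inv m := Subtype.ext (f.symm_apply_apply _)
      right_inv m := Subtype.ext (f.apply_symm_apply _) }
  refine ⟨oppositeLinearEquiv e fun z m => Subtype.ext ?_⟩
  rw [op_single_smul, one_smul]
  change f (Subtype.val (_ • m)) = H'.grp _ * f m * H'.grp _
  rw [op_single_smul, one_smul, map_mul, map_mul, h2, h2]

variable (H)

/-- The collection of the isotypic components of a graded Hopf algebra structure. -/
def components : ModuleCollection.{u, v, max u v w} k rep r where
  -- Components live in universe `max u v`, the collections in `max u v w`.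
  M C := ULift.{max u v w} (H.component (rep C))
  rank_eq C := by
    exact (rank_eq_card_basis ((componentBasis k r (hrep C)).map
      (ULift.moduleEquiv.symm : H.component (rep C) ≃ₗ[k] ULift.{max u v w} _))).trans (by simp)

/-- The members of the collection of isotypic components. -/
def componentsEquiv (C : ConjClasses G) : (components.{u, v, w} H hrep).M C
    ≃ₗ[(MonoidAlgebra k (Subgroup.centralizer {rep C}))ᵐᵒᵖ] H.component (rep C) :=
  ULift.moduleEquiv

end GradedHopfStructureOver

end Transport

/-! ### The bijection on isomorphism classes -/

section Classification

variable {k : Type u} [Field k] {G : Type v} [Group G] {r : ConjClasses G → ℕ}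
  {rep : ConjClasses G → G} (hrep : ∀ C, ConjClasses.mk (rep C) = C)

/-- The isomorphism classes of graded Hopf algebra structures correspond to the isomorphism
classes of collections of modules, through the isotypic components. -/
def classification : Quotient (GradedHopfStructureOver.isoSetoid k r) ≃
    Quotient (ModuleCollection.isoSetoid.{u, v, max u v w} k rep r) :=
  Equiv.ofBijective
    (Quotient.map (fun H => GradedHopfStructureOver.components.{u, v, w} H hrep) fun H H' h C =>
      (GradedHopfStructureOver.Isomorphic.components h (rep C)).map fun e =>
        (H.componentsEquiv hrep C).trans (e.trans (H'.componentsEquiv hrep C).symm)) <| by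
    constructor
    · rintro ⟨H⟩ ⟨H'⟩ h
      refine Quotient.sound (GradedHopfStructureOver.isomorphic_of_components hrep fun C => ?_)
      have h : ∀ C, Nonempty _ := Quotient.exact h
      exact (H.componentsEquiv hrep C).symm.trans
        ((h C).some.trans (H'.componentsEquiv hrep C))
    · rintro ⟨N⟩
      refine ⟨⟦N.hopfStructure hrep⟧, Quotient.sound fun C => ⟨?_⟩⟩
      exact ((N.hopfStructure hrep).componentsEquiv hrep C).trans (N.componentEquiv hrep C).symm

theorem classification_eq_iff (H : GradedHopfStructureOver k r)
    (N : ModuleCollection.{u, v, max u v w} k rep r) :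
    classification.{u, v, w} hrep ⟦H⟧ = ⟦N⟧ ↔ ∀ C, Nonempty
      (H.component (rep C) ≃ₗ[(MonoidAlgebra k (Subgroup.centralizer {rep C}))ᵐᵒᵖ] N.M C) := by
  refine Iff.trans (Quotient.eq (r := ModuleCollection.isoSetoid k rep r)) (forall_congr' fun C => ?_)
  exact ⟨fun h => h.map (H.componentsEquiv hrep C).symm.trans,
    fun h => h.map (H.componentsEquiv hrep C).trans⟩

end Classification

end

end HopfQuivers

theorem mainTheorem5 (k : Type u) [Field k] (G : Type v) [Group G] (r : ConjClasses G → ℕ)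
    (rep : ConjClasses G → G) (hrep : ∀ C, ConjClasses.mk (rep C) = C) :
    ∃ Φ : Quotient (HopfQuivers.GradedHopfStructureOver.isoSetoid k r) ≃
        Quotient (HopfQuivers.ModuleCollection.isoSetoid.{u, v, max u v w} k rep r),
      ∀ (H : HopfQuivers.GradedHopfStructureOver k r)
        (N : HopfQuivers.ModuleCollection.{u, v, max u v w} k rep r),
        Φ ⟦H⟧ = ⟦N⟧ ↔ ∀ C, Nonempty
          (H.component (rep C) ≃ₗ[(MonoidAlgebra k (Subgroup.centralizer {rep C}))ᵐᵒᵖ] N.M C) :=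
  ⟨HopfQuivers.classification.{u, v, w} hrep, HopfQuivers.classification_eq_iff.{u, v, w} hrep⟩
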